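/- Rings and algebras are commutative with unit. Let $E$ be a (Grothendieck) topos with its canonical topology, let $A$ be a sheaf of rings on $E$, and let $\varphi : B \to C$ be a homomorphism of sheaves of $A$-algebras. Let $\pi : C' \to C$ be a square-zero extension of $A$-algebras with ideal $J$; that is, $J$ is a $C$-module and $0 \to J \xrightarrow{i} C' \xrightarrow{\pi} C \to 0$ is an exact sequence of sheaves on $E$ in which $i$ is $C'$-linear, so that $i(J)^2 = 0$. Regard $J$ as a $B$-module through $\varphi$, and let $\mathrm{Der}_A(B,J)$ be the group of $A$-derivations $B \to J$. Let $A\text{-}\mathrm{Alg}/B$ be the category of pairs $(U,D)$, where $U \in E$ and $D$ is a sheaf of $A_U$-algebras on $E/U$ with an $A_U$-algebra map to $B_U$; a morphism $(U_1,D_1) \to (U_2,D_2)$ is a morphism $f : U_1 \to U_2$ of $E$ together with a map $D_1 \to f^*D_2$ of $A_{U_1}$-algebras over $B_{U_1}$. Give it the topology in which a family $(U_i,D_i) \to (U,D)$ is covering if for every $V \to U$ and every finite $\Lambda \subset \Gamma(V,D)$ there exist, locally in $V$, an index $i$, a map $V \to U_i$ over $U$, and a lift of $\Lambda$ to $\Gamma(V,D_i)$.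 Let $\underline{\mathrm{Der}}_A(B,J)$ be the presheaf of abelian groups on $A\text{-}\mathrm{Alg}/B$ sending $(U,D)$ to the group of $A_U$-derivations $D \to J_U$, and let $P$ be the presheaf of sets represented by $B' = C' \times_C B$, placed over the final object of $E$, so that $P(U,D)$ is the set of $A_U$-algebra maps $D \to B'_U$ over $B_U$. **Theorem.** 1. $\underline{\mathrm{Der}}_A(B,J)$ and $P$ are sheaves, and $P$ is a $\underline{\mathrm{Der}}_A(B,J)$-torsor under the action in which a derivation $\delta$ changes the $C'$-component of a map $\psi : D \to B'_U$ by adding $i \circ \delta$. This torsor has a unique class $\omega \in H^1\big(A\text{-}\mathrm{Alg}/B,\ \underline{\mathrm{Der}}_A(B,J)\big)$. (Here $H^1(G) = \mathrm{Ext}^1(\mathbb{Z}, G)$, and the class of a $G$-torsor is the class of an extension of $\mathbb{Z}$ by $G$ whose torsor of local liftings of $1$ is isomorphic to it.) 2. $\omega = 0$ if and only if $B' \to B$ admits a section as a map of $A$-algebras, and $\omega = 0$ if and only if $\varphi$ lifts to a homomorphism of $A$-algebras $\psi : B \to C'$ with $\pi\psi = \varphi$. 3. There is an isomorphism of groups $H^0\big(A\text{-}\mathrm{Alg}/B,\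 \underline{\mathrm{Der}}_A(B,J)\big) \cong \mathrm{Der}_A(B,J)$, under which a derivation of $B$ corresponds to the global section whose value at $(U,D)$ is its composition with $D \to B_U$. If $\omega = 0$, the lifts $\psi$ of $\varphi$ form a torsor under this group, where $\delta$ acts by $\psi \mapsto \psi + i \circ \delta$. -/

import Mathlib

open CategoryTheory Opposite Limits
universe u

/-- An object of the category `A-Alg(E)/B`: a pair `(U, C)` with `U ∈ E` and `C` a sheaf of
commutative `A_U`-algebras on `E/U` equipped with a map of `A_U`-algebras to `B_U`. -/
structure AlgOver {E : Type (u + 1)} [LargeCategory.{u} E] {K : GrothendieckTopology E}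
    {A : Sheaf K CommRingCat.{u}} (B : Under A) where
  /-- the object `U` of `E` -/
  base : E
  /-- the sheaf of rings `C` on `E/U` -/
  alg : Sheaf (K.over base) CommRingCat.{u}
  /-- the structure map `A_U ⟶ C` -/
  str : A.over base ⟶ alg
  /-- the map `C ⟶ B_U` -/
  proj : alg ⟶ B.right.over base
  fac : str ≫ proj = (K.overPullback CommRingCat.{u} base).map B.hom

namespace AlgOver

variable {E : Type (u + 1)} [LargeCategory.{u} E] {K : GrothendieckTopology E}
  {A : Sheaf K CommRingCat.{u}} {B : Under A}

/-- The ring `Γ(V, C)` of sections of `C` over `v : V ⟶ U`. -/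
abbrev sec (X : AlgOver B) {V : E} (v : V ⟶ X.base) : CommRingCat.{u} :=
  X.alg.obj.obj (op (Over.mk v))

/-- Restriction of sections of `C` along a morphism `k : W ⟶ V` over `U`. -/
abbrev res (X : AlgOver B) {V W : E} (k : W ⟶ V) (v : V ⟶ X.base) (w : W ⟶ X.base)
    (h : k ≫ v = w) : X.sec v ⟶ X.sec w :=
  X.alg.obj.map (Over.homMk k h : Over.mk w ⟶ Over.mk v).op

/-- The structure map `Γ(V, A) ⟶ Γ(V, C)`. -/
abbrev strAt (X : AlgOver B) {V : E} (v : V ⟶ X.base) : A.obj.obj (op V) ⟶ X.sec v :=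
  X.str.hom.app (op (Over.mk v))

/-- The projection `Γ(V, C) ⟶ Γ(V, B)`. -/
abbrev projAt (X : AlgOver B) {V : E} (v : V ⟶ X.base) :
    X.sec v ⟶ B.right.obj.obj (op V) :=
  X.proj.hom.app (op (Over.mk v))

/-- A morphism `(U₁, C₁) ⟶ (U₂, C₂)` of `A-Alg(E)/B`: a morphism `f : U₁ ⟶ U₂` of `E` together
with a map of `A`-algebras `C₁ ⟶ f^* C₂` over `B`. Sections of `f^* C₂` over `v : V ⟶ U₁` are
sections of `C₂` over the composite `w = v ≫ f`; the composite is a variable here in order to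
avoid transport along equalities. -/
structure Hom (X Y : AlgOver B) where
  base : X.base ⟶ Y.base
  app {V : E} (v : V ⟶ X.base) (w : V ⟶ Y.base) (h : v ≫ base = w) : X.sec v ⟶ Y.sec w
  naturality {V W : E} (k : W ⟶ V) (v : V ⟶ X.base) (v' : W ⟶ X.base) (w : V ⟶ Y.base)
    (w' : W ⟶ Y.base) (hv : k ≫ v = v') (hw : k ≫ w = w') (h : v ≫ base = w)
    (h' : v' ≫ base = w') :
    X.res k v v' hv ≫ app v' w' h' = app v w h ≫ Y.res k w w' hw
  str_app {V : E} (v : V ⟶ X.base) (w : V ⟶ Y.base) (h : v ≫ base = w) :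
    X.strAt v ≫ app v w h = Y.strAt w
  app_proj {V : E} (v : V ⟶ X.base) (w : V ⟶ Y.base) (h : v ≫ base = w) :
    app v w h ≫ Y.projAt w = X.projAt v

lemma res_id (X : AlgOver B) {V : E} (v : V ⟶ X.base) (h : 𝟙 V ≫ v = v) :
    X.res (𝟙 V) v v h = 𝟙 _ := by
  have : (Over.homMk (𝟙 V) h : Over.mk v ⟶ Over.mk v) = 𝟙 _ := by ext; simp
  simp only [res, this]
  simp

lemma res_comp (X : AlgOver B) {V W Z : E} (k : W ⟶ V) (l : Z ⟶ W) (v : V ⟶ X.base)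
    (w : W ⟶ X.base) (z : Z ⟶ X.base) (h : k ≫ v = w) (h' : l ≫ w = z) :
    X.res k v w h ≫ X.res l w z h' = X.res (l ≫ k) v z (by simp [h, h']) := by
  rw [res, res, res, ← Functor.map_comp, ← op_comp]
  congr 2

lemma strAt_res (X : AlgOver B) {V W : E} (k : W ⟶ V) (v : V ⟶ X.base) (w : W ⟶ X.base)
    (h : k ≫ v = w) : X.strAt v ≫ X.res k v w h = A.obj.map k.op ≫ X.strAt w :=
  (X.str.hom.naturality (Over.homMk k h : Over.mk w ⟶ Over.mk v).op).symm

lemma res_projAt (X : AlgOver B) {V W : E} (k : W ⟶ V) (v : V ⟶ X.base) (w : W ⟶ X.base)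
    (h : k ≫ v = w) : X.res k v w h ≫ X.projAt w = X.projAt v ≫ B.right.obj.map k.op :=
  X.proj.hom.naturality (Over.homMk k h : Over.mk w ⟶ Over.mk v).op

lemma Hom.ext' {X Y : AlgOver B} {f g : Hom X Y} (hb : f.base = g.base)
    (h : ∀ {V : E} (v : V ⟶ X.base) (w : V ⟶ Y.base) (hf : v ≫ f.base = w)
      (hg : v ≫ g.base = w), f.app v w hf = g.app v w hg) : f = g := by
  obtain ⟨fb, fa, f1, f2, f3⟩ := f
  obtain ⟨gb, ga, g1, g2, g3⟩ := g
  obtain rfl : fb = gb := hb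
  obtain rfl : @fa = @ga := by
    funext V v w hw
    exact h v w hw hw
  rfl

/-- The identity morphism. -/
def Hom.id (X : AlgOver B) : Hom X X where
  base := 𝟙 _
  app v w h := X.res (𝟙 _) v w (by simpa using h)
  naturality k v v' w w' hv hw h h' := by simp only [res_comp, Category.id_comp, Category.comp_id]
  str_app v w h := by simp [strAt_res]
  app_proj v w h := by simp [res_projAt]

/-- The composition of morphisms. -/
def Hom.comp {X Y Z : AlgOver B} (f : Hom X Y) (g : Hom Y Z) : Hom X Z where
  base := f.base ≫ g.base
  app v w h := f.app v (v ≫ f.base) rfl ≫ g.app (v ≫ f.base) w (by simpa using h)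
  naturality k v v' w w' hv hw h h' := by
    rw [← Category.assoc, f.naturality k v v' (v ≫ f.base) (v' ≫ f.base) hv
      (by rw [← hv, Category.assoc]) rfl rfl]
    simp only [Category.assoc]
    rw [g.naturality k (v ≫ f.base) (v' ≫ f.base) w w' (by rw [← hv, Category.assoc]) hw
      (by simpa using h) (by simpa using h')]
  str_app v w h := by rw [← Category.assoc, f.str_app, g.str_app]
  app_proj v w h := by rw [Category.assoc, g.app_proj, f.app_proj]

/-- The category `A-Alg(E)/B`. -/
instance : Category (AlgOver B) where
  Hom := Hom
  id := Hom.id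
  comp := Hom.comp
  id_comp {X Y} f := by
    refine Hom.ext' (Category.id_comp f.base) fun v w h h' => ?_
    change X.res (𝟙 _) v (v ≫ 𝟙 X.base) _ ≫ f.app (v ≫ 𝟙 X.base) w _ = _
    rw [f.naturality (𝟙 _) v (v ≫ 𝟙 X.base) w w (by simp) (by simp) h' (by simpa using h'), res_id,
      Category.comp_id]
  comp_id {X Y} f := by
    refine Hom.ext' (Category.comp_id f.base) fun v w h h' => ?_
    change f.app v (v ≫ f.base) _ ≫ Y.res (𝟙 _) (v ≫ f.base) w _ = _
    obtain rfl := h'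
    rw [res_id, Category.comp_id]
  assoc {X Y Z W} f g h := by
    refine Hom.ext' (Category.assoc f.base g.base h.base) fun {V} v w h1 h2 => ?_
    have key : ∀ (z z' : V ⟶ Z.base) (_ : z = z') (e₁ : (v ≫ f.base) ≫ g.base = z)
        (e₂ : z ≫ h.base = w) (e₃ : (v ≫ f.base) ≫ g.base = z') (e₄ : z' ≫ h.base = w),
        (f.app v (v ≫ f.base) rfl ≫ g.app (v ≫ f.base) z e₁) ≫ h.app z w e₂ =
          f.app v (v ≫ f.base) rfl ≫ g.app (v ≫ f.base) z' e₃ ≫ h.app z' w e₄ := by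
      rintro z _ rfl e₁ e₂ e₃ e₄
      rw [Category.assoc]
    have h3 : v ≫ (f.base ≫ g.base) ≫ h.base = w := h1
    exact key _ _ (Category.assoc v f.base g.base).symm (Category.assoc v f.base g.base)
      (by simpa using h3) rfl (by simpa using h3)

lemma id_app (X : AlgOver B) {V : E} (v w : V ⟶ X.base) (h : v ≫ 𝟙 X.base = w) :
    Hom.app (𝟙 X) v w h = X.res (𝟙 V) v w (by simpa using h) := rfl

lemma comp_app {X Y Z : AlgOver B} (f : X ⟶ Y) (g : Y ⟶ Z) {V : E} (v : V ⟶ X.base)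
    (w : V ⟶ Y.base) (z : V ⟶ Z.base) (hw : v ≫ f.base = w) (hz : w ≫ g.base = z)
    (h : v ≫ (f ≫ g).base = z) :
    Hom.app (f ≫ g) v z h = f.app v w hw ≫ g.app w z hz := by
  obtain rfl := hw
  rfl

/-- The sieve on `V` of all `k : W ⟶ V` such that, for some single `r : (U', C') ⟶ (U, C)` in `R`,
the map `W ⟶ U` factors through a map `W ⟶ U'` along which the restrictions to `W` of
all elements of `Λ ⊆ Γ(V, C)` lift to `Γ(W, C')`. -/
def liftingSieve {X : AlgOver B} (R : Sieve X) {V : E} (v : V ⟶ X.base) (Λ : Finset (X.sec v)) :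
    Sieve V where
  arrows W k := ∃ (Y : AlgOver B) (r : Y ⟶ X) (_ : R r) (w : W ⟶ Y.base)
    (h : w ≫ r.base = k ≫ v), ∀ c ∈ Λ, ∃ y : Y.sec w, r.app w (k ≫ v) h y = X.res k v (k ≫ v) rfl c
  downward_closed {W W'} k := by
    rintro ⟨Y, r, hr, w, h, H⟩ l
    refine ⟨Y, r, hr, l ≫ w, by simp [h], fun c hc => ?_⟩
    obtain ⟨y, hy⟩ := H c hc
    refine ⟨Y.res l w (l ≫ w) rfl y, ?_⟩
    have := ConcreteCategory.congr_hom (r.naturality l w (l ≫ w) (k ≫ v) ((l ≫ k) ≫ v) rfl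
      (by simp) h (by simp [h])) y
    simp only [ConcreteCategory.comp_apply] at this
    rw [this, hy, ← ConcreteCategory.comp_apply, res_comp]

lemma mem_liftingSieve {X : AlgOver B} {R : Sieve X} {V : E} {v : V ⟶ X.base}
    {Λ : Finset (X.sec v)} {W : E} {k : W ⟶ V} :
    liftingSieve R v Λ k ↔ ∃ (Y : AlgOver B) (r : Y ⟶ X) (_ : R r) (w : W ⟶ Y.base)
      (h : w ≫ r.base = k ≫ v), ∀ c ∈ Λ, ∃ y : Y.sec w,
        r.app w (k ≫ v) h y = X.res k v (k ≫ v) rfl c := Iff.rfl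

/-- The restriction of `C` along `x : W ⟶ U`, as a sheaf of rings on `E/W`. -/
abbrev restrict (X : AlgOver B) {W : E} (x : W ⟶ X.base) : Sheaf (K.over W) CommRingCat.{u} :=
  (K.overMapPullback CommRingCat.{u} x).obj X.alg

/-- The structure map of the restriction. -/
def restrictStr (X : AlgOver B) {W : E} (x : W ⟶ X.base) : A.over W ⟶ X.restrict x where
  hom :=
    { app V := X.strAt (V.unop.hom ≫ x)
      naturality V V' k := (X.strAt_res k.unop.left _ _ (by simp)).symm }

/-- The projection of the restriction. -/
def restrictProj (X : AlgOver B) {W : E} (x : W ⟶ X.base) :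
    X.restrict x ⟶ B.right.over W where
  hom :=
    { app V := X.projAt (V.unop.hom ≫ x)
      naturality V V' k := X.res_projAt k.unop.left _ _ (by simp) }

/-- The map induced on restrictions by a morphism. -/
def restrictMap {X Y : AlgOver B} (r : Y ⟶ X) {W : E} (y : W ⟶ Y.base) (x : W ⟶ X.base)
    (h : y ≫ r.base = x) : Y.restrict y ⟶ X.restrict x where
  hom :=
    { app V := r.app (V.unop.hom ≫ y) (V.unop.hom ≫ x) (by simp [h])
      naturality V V' k := r.naturality k.unop.left _ _ _ _ (by simp) (by simp) _ _ }

lemma strAt_projAt (X : AlgOver B) {V : E} (v : V ⟶ X.base) :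
    X.strAt v ≫ X.projAt v = B.hom.hom.app (op V) :=
  congrArg (fun f => f.hom.app (op (Over.mk v))) X.fac

lemma restrictStr_map {X Y : AlgOver B} (r : Y ⟶ X) {W : E} (y : W ⟶ Y.base) (x : W ⟶ X.base)
    (h : y ≫ r.base = x) : Y.restrictStr y ≫ restrictMap r y x h = X.restrictStr x := by
  ext1
  ext V : 2
  exact r.str_app _ _ _

lemma restrictMap_proj {X Y : AlgOver B} (r : Y ⟶ X) {W : E} (y : W ⟶ Y.base) (x : W ⟶ X.base)
    (h : y ≫ r.base = x) : restrictMap r y x h ≫ X.restrictProj x = Y.restrictProj y := by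
  ext1
  ext V : 2
  exact r.app_proj _ _ _

lemma restrictStr_proj (X : AlgOver B) {W : E} (x : W ⟶ X.base) :
    X.restrictStr x ≫ X.restrictProj x = (K.overPullback CommRingCat.{u} W).map B.hom := by
  ext1
  ext V : 2
  exact X.strAt_projAt _

/-- A morphism of `A-Alg(E)/B` from its components `Γ(V, C₁) ⟶ Γ(V, f^* C₂)`. -/
def homMk {P Y : AlgOver B} (y : P.base ⟶ Y.base)
    (f : ∀ {V : E} (v : V ⟶ P.base), P.sec v ⟶ Y.sec (v ≫ y))
    (h₀ : ∀ {V W : E} (k : W ⟶ V) (v : V ⟶ P.base) (v' : W ⟶ P.base) (h : k ≫ v = v'),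
      P.res k v v' h ≫ f v' = f v ≫ Y.res k (v ≫ y) (v' ≫ y) (by simp [← h]))
    (h₁ : ∀ {V : E} (v : V ⟶ P.base), P.strAt v ≫ f v = Y.strAt (v ≫ y))
    (h₂ : ∀ {V : E} (v : V ⟶ P.base), f v ≫ Y.projAt (v ≫ y) = P.projAt v) : P ⟶ Y where
  base := y
  app {V} v w h := f v ≫ Y.res (𝟙 V) (v ≫ y) w ((Category.id_comp _).trans h)
  naturality {V W} k v v' w w' hv hw h h' := by
    obtain rfl := h
    obtain rfl := h'
    rw [res_id, res_id, Category.comp_id, Category.comp_id, h₀]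
  str_app {V} v w h := by
    obtain rfl := h
    rw [res_id, Category.comp_id, h₁]
  app_proj {V} v w h := by
    obtain rfl := h
    rw [res_id, Category.comp_id, h₂]

lemma homMk_app {P Y : AlgOver B} (y : P.base ⟶ Y.base)
    (f : ∀ {V : E} (v : V ⟶ P.base), P.sec v ⟶ Y.sec (v ≫ y)) (h₀ h₁ h₂) {V : E}
    (v : V ⟶ P.base) (h : v ≫ y = v ≫ y) :
    Hom.app (homMk y f h₀ h₁ h₂ : P ⟶ Y) v (v ≫ y) h = f v := by
  change f v ≫ Y.res (𝟙 V) (v ≫ y) (v ≫ y) _ = f v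
  rw [res_id, Category.comp_id]

/-- The fibre product over `(U, C)` of the restrictions to `W` of `(U₁, C₁)` and `(U₂, C₂)`;
it serves to check that coverings are stable under base change. -/
lemma exists_fibreProduct {X Y Z : AlgOver B} (r : Y ⟶ X) (g : Z ⟶ X) {W : E} (y : W ⟶ Y.base)
    (z : W ⟶ Z.base) (x : W ⟶ X.base) (hy : y ≫ r.base = x) (hz : z ≫ g.base = x) :
    ∃ (P : AlgOver B) (p : P ⟶ Y) (q : P ⟶ Z) (_ : p ≫ r = q ≫ g) (w : W ⟶ P.base)
      (hp : w ≫ p.base = y) (hq : w ≫ q.base = z),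
      ∀ (a : Y.sec y) (b : Z.sec z), r.app y x hy a = g.app z x hz b →
        ∃ c : P.sec w, p.app w y hp c = a ∧ q.app w z hq c = b := by
  let f₁ := restrictMap r y x hy
  let f₂ := restrictMap g z x hz
  let P : AlgOver B :=
    { base := W
      alg := pullback f₁ f₂
      str := pullback.lift (Y.restrictStr y) (Z.restrictStr z)
        (by rw [restrictStr_map, restrictStr_map])
      proj := pullback.fst f₁ f₂ ≫ Y.restrictProj y
      fac := by rw [pullback.lift_fst_assoc, restrictStr_proj] }
  have hsnd : pullback.snd f₁ f₂ ≫ Z.restrictProj z = pullback.fst f₁ f₂ ≫ Y.restrictProj y := by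
    rw [← restrictMap_proj g z x hz, ← restrictMap_proj r y x hy]
    exact (pullback.condition_assoc _).symm
  let pa : ∀ {V : E} (v : V ⟶ W), P.sec v ⟶ Y.sec (v ≫ y) := fun {V} v =>
    (pullback.fst f₁ f₂).hom.app (op (Over.mk v))
  let qa : ∀ {V : E} (v : V ⟶ W), P.sec v ⟶ Z.sec (v ≫ z) := fun {V} v =>
    (pullback.snd f₁ f₂).hom.app (op (Over.mk v))
  let p : P ⟶ Y := homMk y pa
    (fun k v v' h => (pullback.fst f₁ f₂).hom.naturality (Over.homMk k h : Over.mk v' ⟶ Over.mk v).op)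
    (fun {V} v => congrArg (fun f => f.hom.app (op (Over.mk v)))
      (pullback.lift_fst (f := f₁) (g := f₂) (Y.restrictStr y) (Z.restrictStr z)
        (by rw [restrictStr_map, restrictStr_map])))
    (fun {V} v => rfl)
  let q : P ⟶ Z := homMk z qa
    (fun k v v' h => (pullback.snd f₁ f₂).hom.naturality (Over.homMk k h : Over.mk v' ⟶ Over.mk v).op)
    (fun {V} v => congrArg (fun f => f.hom.app (op (Over.mk v)))
      (pullback.lift_snd (f := f₁) (g := f₂) (Y.restrictStr y) (Z.restrictStr z)
        (by rw [restrictStr_map, restrictStr_map])))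
    (fun {V} v => congrArg (fun f => f.hom.app (op (Over.mk v))) hsnd)
  have hcond : ∀ {V : E} (v : V ⟶ W), pa v ≫ r.app (v ≫ y) (v ≫ x) (by simp [hy]) =
      qa v ≫ g.app (v ≫ z) (v ≫ x) (by simp [hz]) := fun v =>
    congrArg (fun f => f.hom.app (op (Over.mk v))) (pullback.condition (f := f₁) (g := f₂))
  refine ⟨P, p, q, ?_, 𝟙 W, Category.id_comp y, Category.id_comp z, fun a b hab => ?_⟩
  · refine Hom.ext' (hy.trans hz.symm) fun {V} v w h h' => ?_
    obtain rfl : v ≫ x = w := by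
      rw [← h, ← hy]; rfl
    have e₁ : Hom.app p v (v ≫ y) rfl = pa v := homMk_app _ _ _ _ _ _ _
    have e₂ : Hom.app q v (v ≫ z) rfl = qa v := homMk_app _ _ _ _ _ _ _
    have hy' : (v ≫ y) ≫ r.base = v ≫ x := by rw [Category.assoc, hy]
    have hz' : (v ≫ z) ≫ g.base = v ≫ x := by rw [Category.assoc, hz]
    calc Hom.app (p ≫ r) v (v ≫ x) h
        = Hom.app p v (v ≫ y) rfl ≫ r.app (v ≫ y) (v ≫ x) hy' := comp_app p r v _ _ rfl hy' h
      _ = Hom.app q v (v ≫ z) rfl ≫ g.app (v ≫ z) (v ≫ x) hz' := by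
        rw [e₁, e₂]
        exact hcond v
      _ = Hom.app (q ≫ g) v (v ≫ x) h' := (comp_app q g v _ _ rfl hz' h').symm
  · have hpb := (IsPullback.of_hasPullback f₁ f₂).map
      (sheafToPresheaf (K.over W) CommRingCat.{u} ⋙ (evaluation _ _).obj (op (Over.mk (𝟙 W))) ⋙
        forget CommRingCat.{u})
    let ι : ∀ (X : AlgOver B) (x : W ⟶ X.base), X.sec x ⟶ X.sec (𝟙 W ≫ x) :=
      fun X x => X.res (𝟙 W) x (𝟙 W ≫ x) rfl
    obtain ⟨c, hc₁, hc₂⟩ := Types.exists_of_isPullback hpb (ι Y y a) (ι Z z b) (by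
      have e₁ := ConcreteCategory.congr_hom (r.naturality (𝟙 W) y (𝟙 W ≫ y) x (𝟙 W ≫ x) rfl rfl hy
        (by simp [hy])) a
      have e₂ := ConcreteCategory.congr_hom (g.naturality (𝟙 W) z (𝟙 W ≫ z) x (𝟙 W ≫ x) rfl rfl hz
        (by simp [hz])) b
      simp only [ConcreteCategory.comp_apply] at e₁ e₂
      refine e₁.trans (Eq.trans ?_ e₂.symm)
      rw [hab])
    have key : ∀ (X : AlgOver B) (x : W ⟶ X.base) (h : 𝟙 W ≫ 𝟙 W ≫ x = x) (a : X.sec x),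
        X.res (𝟙 W) (𝟙 W ≫ x) x h (ι X x a) = a := by
      intro X x h a
      change X.res (𝟙 W) (𝟙 W ≫ x) x _ (X.res (𝟙 W) x (𝟙 W ≫ x) rfl a) = a
      rw [← ConcreteCategory.comp_apply, res_comp]
      simp only [Category.comp_id]
      rw [res_id]
      rfl
    exact ⟨c, (congrArg (Y.res (𝟙 W) (𝟙 W ≫ y) y (by simp)) hc₁).trans (key Y y (by simp) a),
      (congrArg (Z.res (𝟙 W) (𝟙 W ≫ z) z (by simp)) hc₂).trans (key Z z (by simp) b)⟩

variable (B) in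
/-- The topology of `A-Alg(E)/B`: a sieve `R` of `(U, C)` is covering if for every `V ⟶ U` and every
finite set `Λ` of sections of `C` over `V`, there exist, locally in `V`, a member
`(U', C') ⟶ (U, C)` of `R`, a map `V ⟶ U'` over `U` and a lift of `Λ` to `Γ(V, C')`. -/
def topology : GrothendieckTopology (AlgOver B) where
  sieves X := {R | ∀ (V : E) (v : V ⟶ X.base) (Λ : Finset (X.sec v)), liftingSieve R v Λ ∈ K V}
  top_mem' X V v Λ := by
    refine K.superset_covering (fun W k _ => ?_) (K.top_mem V)
    refine ⟨X, 𝟙 X, trivial, k ≫ v, Category.comp_id _, fun c _ => ⟨X.res k v (k ≫ v) rfl c, ?_⟩⟩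
    rw [id_app, res_id]
    rfl
  pullback_stable' X Z R g hR V v Λ := by
    classical
    refine K.superset_covering (fun W k hk => ?_)
      (hR V (v ≫ g.base) (Λ.image (g.app v (v ≫ g.base) rfl)))
    obtain ⟨Y, r, hr, y, h, H⟩ := hk
    obtain ⟨P, p, q, hpq, w, _, hq, HP⟩ := exists_fibreProduct r g y (k ≫ v) (k ≫ v ≫ g.base) h
      (by simp)
    refine ⟨P, q, ?_, w, hq, fun c hc => ?_⟩
    · change R (q ≫ g)
      rw [← hpq]
      exact R.downward_closed hr p
    · obtain ⟨a, ha⟩ := H _ (Finset.mem_image_of_mem _ hc)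
      suffices hs : r.app y (k ≫ v ≫ g.base) h a = g.app (k ≫ v) (k ≫ v ≫ g.base) (by simp)
          (Z.res k v (k ≫ v) rfl c) by
        obtain ⟨b, -, hb⟩ := HP a _ hs
        exact ⟨b, hb⟩
      have := ConcreteCategory.congr_hom (g.naturality k v (k ≫ v) (v ≫ g.base) (k ≫ v ≫ g.base)
        rfl rfl rfl (by simp)) c
      simp only [ConcreteCategory.comp_apply] at this
      rw [this]
      exact ha
  transitive' X R hR S hS V v Λ := by
    classical
    refine K.transitive (hR V v Λ) _ fun W k hk => ?_
    obtain ⟨Y, r, hr, w, h, H⟩ := hk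
    choose! lift hlift using H
    refine K.superset_covering (fun W' l hl => ?_) (hS hr W w (Λ.image lift))
    obtain ⟨Z, s, hs, z, h', H'⟩ := hl
    refine ⟨Z, s ≫ r, hs, z, ?_, fun c hc => ?_⟩
    · change z ≫ s.base ≫ r.base = _
      rw [reassoc_of% h', h, Category.assoc]
    · obtain ⟨y, hy⟩ := H' _ (Finset.mem_image_of_mem _ hc)
      refine ⟨y, ?_⟩
      rw [comp_app s r z (l ≫ w) ((l ≫ k) ≫ v) h' (by simp [h]), ConcreteCategory.comp_apply, hy]
      have := ConcreteCategory.congr_hom (r.naturality l w (l ≫ w) (k ≫ v) ((l ≫ k) ≫ v) rfl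
        (by simp) h (by simp [h])) (lift c)
      simp only [ConcreteCategory.comp_apply] at this
      rw [this, hlift c hc, ← ConcreteCategory.comp_apply, res_comp]

end AlgOver

section Derivations

variable {E : Type (u + 1)} [LargeCategory.{u} E] {K : GrothendieckTopology E}
  {A : Sheaf K CommRingCat.{u}}

/-- A sheaf of modules over the sheaf of rings `C`. -/
structure AlgModule (C : Under A) where
  val : PresheafOfModules.{u} (C.right.obj ⋙ forget₂ CommRingCat.{u} RingCat.{u})
  isSheaf : Presheaf.IsSheaf K val.presheaf

/-- `π : C' ⟶ C` is a square-zero extension of `A`-algebras with ideal `M`, a `C`-module: an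
exact sequence `0 ⟶ M ⟶ C' ⟶ C ⟶ 0` of sheaves on `E`, where `M ⟶ C'` is `C'`-linear and its image
has square zero. -/
structure SquareZeroExtension {C' C : Under A} (π : C' ⟶ C) (M : AlgModule C) where
  /-- the inclusion of the ideal `M` in `C'` -/
  incl (U : Eᵒᵖ) : M.val.obj U →+ C'.right.obj.obj U
  naturality {U V : Eᵒᵖ} (k : U ⟶ V) (m : M.val.obj U) :
    incl V (M.val.map k m) = C'.right.obj.map k (incl U m)
  injective (U : Eᵒᵖ) : Function.Injective (incl U)
  exact (U : Eᵒᵖ) (x : C'.right.obj.obj U) :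
    π.right.hom.app U x = 0 ↔ ∃ m, incl U m = x
  linear (U : Eᵒᵖ) (x : C'.right.obj.obj U) (m : M.val.obj U) :
    incl U ((π.right.hom.app U x : C.right.obj.obj U) • m) = x * incl U m
  square_zero (U : Eᵒᵖ) (m n : M.val.obj U) : incl U m * incl U n = 0
  locally_surjective : Sheaf.IsLocallySurjective π.right

variable {B C : Under A}

/-- `Der_A(B, M)`: the `A`-derivations from `B` to the `C`-module `M`, which is regarded as a
`B`-module by means of `φ : B ⟶ C`. -/
@[ext]
structure Der (φ : B ⟶ C) (M : AlgModule C) where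
  app (U : Eᵒᵖ) : B.right.obj.obj U →+ M.val.obj U
  naturality {U V : Eᵒᵖ} (k : U ⟶ V) (b : B.right.obj.obj U) :
    app V (B.right.obj.map k b) = M.val.map k (app U b)
  leibniz (U : Eᵒᵖ) (b c : B.right.obj.obj U) :
    app U (b * c) = (φ.right.hom.app U b : C.right.obj.obj U) • app U c +
      (φ.right.hom.app U c : C.right.obj.obj U) • app U b
  app_str (U : Eᵒᵖ) (a : A.obj.obj U) : app U (B.hom.hom.app U a) = 0

/-- The sections over `X = (U, D)` of the sheaf of derivations on `A-Alg(E)/B`: the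
`A_U`-derivations from `D` to `M_U`, which is regarded as a `D`-module by means of
`D ⟶ B_U ⟶ C_U`. -/
@[ext]
structure LocalDer (φ : B ⟶ C) (M : AlgModule C) (X : AlgOver B) where
  app {V : E} (v : V ⟶ X.base) : X.sec v →+ M.val.obj (op V)
  naturality {V W : E} (k : W ⟶ V) (v : V ⟶ X.base) (w : W ⟶ X.base) (h : k ≫ v = w)
    (c : X.sec v) : app w (X.res k v w h c) = M.val.map k.op (app v c)
  leibniz {V : E} (v : V ⟶ X.base) (c d : X.sec v) :
    app v (c * d) = (φ.right.hom.app (op V) (X.projAt v c) : C.right.obj.obj (op V)) • app v d +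
      (φ.right.hom.app (op V) (X.projAt v d) : C.right.obj.obj (op V)) • app v c
  app_str {V : E} (v : V ⟶ X.base) (a : A.obj.obj (op V)) : app v (X.strAt v a) = 0

namespace Der

variable {φ : B ⟶ C} {M : AlgModule C}

lemma app_injective : Function.Injective (Der.app : Der φ M → _) := fun _ _ h => Der.ext h

instance : Zero (Der φ M) :=
  ⟨{ app := fun _ => 0
     naturality := fun k b => (map_zero (M.val.map k).hom).symm
     leibniz := fun U b c => by simp
     app_str := fun U a => rfl }⟩

instance : Add (Der φ M) :=
  ⟨fun D D' =>
   { app := fun U => D.app U + D'.app U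
     naturality := fun k b => by
      rw [AddMonoidHom.add_apply, D.naturality, D'.naturality]
      exact (map_add (M.val.map k).hom _ _).symm
     leibniz := fun U b c => by
      simp only [AddMonoidHom.add_apply, D.leibniz, D'.leibniz, smul_add]
      abel
     app_str := fun U a => by simp [D.app_str, D'.app_str] }⟩

instance : Neg (Der φ M) :=
  ⟨fun D =>
   { app := fun U => -D.app U
     naturality := fun k b => by
      rw [AddMonoidHom.neg_apply, D.naturality]
      exact (map_neg (M.val.map k).hom _).symm
     leibniz := fun U b c => by
      simp only [AddMonoidHom.neg_apply, D.leibniz, smul_neg]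
      abel
     app_str := fun U a => by simp [D.app_str] }⟩

instance : AddCommGroup (Der φ M) where
  add_assoc _ _ _ := app_injective (funext fun _ => add_assoc _ _ _)
  zero_add _ := app_injective (funext fun _ => zero_add _)
  add_zero _ := app_injective (funext fun _ => add_zero _)
  add_comm _ _ := app_injective (funext fun _ => add_comm _ _)
  neg_add_cancel _ := app_injective (funext fun _ => neg_add_cancel _)
  nsmul := nsmulRec
  zsmul := zsmulRec

end Der

namespace LocalDer

variable {φ : B ⟶ C} {M : AlgModule C} {X Y Z : AlgOver B}

lemma ext' {D D' : LocalDer φ M X}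
    (h : ∀ {V : E} (v : V ⟶ X.base) (c : X.sec v), D.app v c = D'.app v c) : D = D' := by
  refine LocalDer.ext ?_
  funext V v
  exact AddMonoidHom.ext (h v)

instance : Zero (LocalDer φ M X) :=
  ⟨{ app := fun _ => 0
     naturality := fun k v w h c => (map_zero (M.val.map k.op).hom).symm
     leibniz := fun v c d => by simp
     app_str := fun v a => rfl }⟩

instance : Add (LocalDer φ M X) :=
  ⟨fun D D' =>
   { app := fun v => D.app v + D'.app v
     naturality := fun k v w h c => by
      rw [AddMonoidHom.add_apply, D.naturality, D'.naturality]
      exact (map_add (M.val.map k.op).hom _ _).symm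
     leibniz := fun v c d => by
      simp only [AddMonoidHom.add_apply, D.leibniz, D'.leibniz, smul_add]
      abel
     app_str := fun v a => by simp [D.app_str, D'.app_str] }⟩

instance : Neg (LocalDer φ M X) :=
  ⟨fun D =>
   { app := fun v => -D.app v
     naturality := fun k v w h c => by
      rw [AddMonoidHom.neg_apply, D.naturality]
      exact (map_neg (M.val.map k.op).hom _).symm
     leibniz := fun v c d => by
      simp only [AddMonoidHom.neg_apply, D.leibniz, smul_neg]
      abel
     app_str := fun v a => by simp [D.app_str] }⟩

instance : AddCommGroup (LocalDer φ M X) where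
  add_assoc _ _ _ := ext' fun _ _ => add_assoc _ _ _
  zero_add _ := ext' fun _ _ => zero_add _
  add_zero _ := ext' fun _ _ => add_zero _
  add_comm _ _ := ext' fun _ _ => add_comm _ _
  neg_add_cancel _ := ext' fun _ _ => neg_add_cancel _
  nsmul := nsmulRec
  zsmul := zsmulRec

/-- The pull-back of a derivation along a morphism of `A-Alg(E)/B`. -/
def pull (f : X ⟶ Y) : LocalDer φ M Y →+ LocalDer φ M X where
  toFun D :=
    { app := fun v => (D.app (v ≫ f.base)).comp (f.app v (v ≫ f.base) rfl).hom.toAddMonoidHom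
      naturality := fun k v w h c => by
        have := ConcreteCategory.congr_hom (f.naturality k v w (v ≫ f.base) (w ≫ f.base) h
          (by rw [← h, Category.assoc]) rfl rfl) c
        simp only [ConcreteCategory.comp_apply] at this
        refine Eq.trans ?_ (D.naturality k (v ≫ f.base) (w ≫ f.base)
          (by rw [← h, Category.assoc]) (f.app v _ rfl c))
        exact congrArg (D.app (w ≫ f.base)) this
      leibniz := fun v c d => by
        have e : ∀ c : X.sec v, Y.projAt (v ≫ f.base) (f.app v (v ≫ f.base) rfl c) =
            X.projAt v c := fun c =>
          ConcreteCategory.congr_hom (f.app_proj v (v ≫ f.base) rfl) c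
        refine (congrArg (D.app (v ≫ f.base)) (map_mul (f.app v (v ≫ f.base) rfl).hom c d)).trans ?_
        refine (D.leibniz (v ≫ f.base) (f.app v _ rfl c) (f.app v _ rfl d)).trans ?_
        rw [e, e]
        rfl
      app_str := fun v a => by
        refine Eq.trans ?_ (D.app_str (v ≫ f.base) a)
        exact congrArg (D.app (v ≫ f.base))
          (ConcreteCategory.congr_hom (f.str_app v (v ≫ f.base) rfl) a) }
  map_zero' := rfl
  map_add' _ _ := rfl

lemma pull_id (D : LocalDer φ M X) : pull (𝟙 X) D = D := by
  refine ext' fun {V} v c => ?_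
  change D.app (v ≫ 𝟙 X.base) (X.res (𝟙 V) v (v ≫ 𝟙 X.base) _ c) = D.app v c
  refine (D.naturality (𝟙 V) v (v ≫ 𝟙 X.base) (by simp) c).trans ?_
  exact ConcreteCategory.congr_hom (M.val.presheaf.map_id (op V)) _

lemma pull_comp (f : X ⟶ Y) (g : Y ⟶ Z) (D : LocalDer φ M Z) :
    pull (f ≫ g) D = pull f (pull g D) := by
  refine ext' fun {V} v c => ?_
  change D.app (v ≫ f.base ≫ g.base) (AlgOver.Hom.app (f ≫ g) v (v ≫ f.base ≫ g.base) rfl c) =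
    D.app ((v ≫ f.base) ≫ g.base)
      (g.app (v ≫ f.base) ((v ≫ f.base) ≫ g.base) rfl (f.app v (v ≫ f.base) rfl c))
  have key : ∀ (z : V ⟶ Z.base) (hz : v ≫ (f ≫ g).base = z) (hz' : (v ≫ f.base) ≫ g.base = z),
      D.app z (AlgOver.Hom.app (f ≫ g) v z hz c) = D.app ((v ≫ f.base) ≫ g.base)
      (g.app (v ≫ f.base) ((v ≫ f.base) ≫ g.base) rfl (f.app v (v ≫ f.base) rfl c)) := by
    rintro z hz rfl
    rfl
  exact key _ rfl (Category.assoc _ _ _)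

end LocalDer

/-- The presheaf of abelian groups of `A`-derivations into `M` on `A-Alg(E)/B`. -/
def derPresheaf (φ : B ⟶ C) (M : AlgModule C) : (AlgOver B)ᵒᵖ ⥤ AddCommGrpCat.{u + 1} where
  obj X := AddCommGrpCat.of (LocalDer φ M X.unop)
  map f := AddCommGrpCat.ofHom (LocalDer.pull f.unop)
  map_id X := by
    refine AddCommGrpCat.hom_ext (AddMonoidHom.ext fun D => ?_)
    exact LocalDer.pull_id D
  map_comp f g := by
    refine AddCommGrpCat.hom_ext (AddMonoidHom.ext fun D => ?_)
    exact LocalDer.pull_comp g.unop f.unop D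

/-- The restriction of an `A`-derivation of `B` to an object `(U, D)` of `A-Alg(E)/B`, that is, its
composition with `D ⟶ B_U`. -/
def Der.restrict {φ : B ⟶ C} {M : AlgModule C} (D : Der φ M) (X : AlgOver B) :
    LocalDer φ M X where
  app {V} v := (D.app (op V)).comp (X.projAt v).hom.toAddMonoidHom
  naturality {V W} k v w h c := by
    refine Eq.trans ?_ (D.naturality k.op (X.projAt v c))
    exact congrArg (D.app (op W)) (ConcreteCategory.congr_hom (X.res_projAt k v w h) c)
  leibniz {V} v c d :=
    (congrArg (D.app (op V)) (map_mul (X.projAt v).hom c d)).trans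
      (D.leibniz (op V) (X.projAt v c) (X.projAt v d))
  app_str {V} v a :=
    (congrArg (D.app (op V)) (ConcreteCategory.congr_hom (X.strAt_projAt v) a)).trans
      (D.app_str (op V) a)

/-- The object `(T, B'_T)` of `A-Alg(E)/B` given by an `A`-algebra `q : B' ⟶ B` over `B`. For `T` the
final object of `E`, this is `B'` as an object of `A-Alg(E)/B`. -/
def AlgOver.ofUnder (T : E) {B' : Under A} (q : B' ⟶ B) : AlgOver B where
  base := T
  alg := B'.right.over T
  str := (K.overPullback CommRingCat.{u} T).map B'.hom
  proj := (K.overPullback CommRingCat.{u} T).map q.right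
  fac := by rw [← Functor.map_comp, Under.w]

end Derivations

/-- `E` is a Grothendieck topos: for the canonical topology, `E` has a small set of topological
generators, and every sheaf of sets is representable. -/
structure IsTopos (E : Type (u + 1)) [LargeCategory.{u} E] : Prop where
  exists_generators : ∃ (ι : Type u) (g : ι → E), ∀ X : E,
    Sieve.generate (fun Y (_ : Y ⟶ X) => Y ∈ Set.range g) ∈ Sheaf.canonicalTopology E X
  isRepresentable (F : Sheaf (Sheaf.canonicalTopology E) (Type u)) : F.obj.IsRepresentable

section Torsors

universe w

variable {D : Type w} [SmallCategory.{w} D] {J : GrothendieckTopology D}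

/-- The structure of a `G`-torsor on a sheaf of sets `P`: an action of `G` such that
`G × P ⟶ P × P` is an isomorphism, and such that `P` locally has sections. -/
structure SheafTorsor (G : Sheaf J AddCommGrpCat.{w}) (P : Sheaf J (Type w)) where
  vadd (X : Dᵒᵖ) : G.obj.obj X → P.obj.obj X → P.obj.obj X
  zero_vadd (X : Dᵒᵖ) (x : P.obj.obj X) : vadd X 0 x = x
  add_vadd (X : Dᵒᵖ) (g g' : G.obj.obj X) (x : P.obj.obj X) :
    vadd X (g + g') x = vadd X g (vadd X g' x)
  map_vadd {X Y : Dᵒᵖ} (f : X ⟶ Y) (g : G.obj.obj X) (x : P.obj.obj X) :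
    P.obj.map f (vadd X g x) = vadd Y (G.obj.map f g) (P.obj.map f x)
  bijective (X : Dᵒᵖ) :
    Function.Bijective (fun z : G.obj.obj X × P.obj.obj X => (vadd X z.1 z.2, z.2))
  locally_nonempty (X : D) : ∃ S ∈ J X, ∀ ⦃Y : D⦄ (f : Y ⟶ X), S f → Nonempty (P.obj.obj (op Y))

variable (J) in
/-- The constant sheaf `ℤ`. -/
noncomputable abbrev constInt : Sheaf J AddCommGrpCat.{w} :=
  (constantSheaf J AddCommGrpCat.{w}).obj (AddCommGrpCat.of (ULift.{w} ℤ))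

variable (J) in
/-- The section `1` of the constant sheaf `ℤ` over `X`. -/
noncomputable def constOne (X : Dᵒᵖ) : (constInt J).obj.obj X :=
  (toSheafify J ((Functor.const Dᵒᵖ).obj (AddCommGrpCat.of (ULift.{w} ℤ)))).app X (ULift.up 1)

/-- `ω ∈ H¹(D, G) = Ext¹(ℤ, G)` is the class of the `G`-torsor `P`: it is the class of an extension
`0 ⟶ G ⟶ M ⟶ ℤ ⟶ 0` for which `P` is isomorphic, as a `G`-torsor, to the torsor of local
liftings of the section `1` to `M`. (A `G`-equivariant map between torsors is an isomorphism.) -/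
def SheafTorsor.IsClass {G : Sheaf J AddCommGrpCat.{w}} {P : Sheaf J (Type w)}
    (τ : SheafTorsor G P) (ω : G.H 1) : Prop :=
  ∃ (M : Sheaf J AddCommGrpCat.{w}) (i : G ⟶ M) (p : M ⟶ constInt J) (hip : i ≫ p = 0)
    (hM : (ShortComplex.mk i p hip).ShortExact) (s : P.obj ⟶ M.obj ⋙ forget AddCommGrpCat.{w}),
    (∀ (X : Dᵒᵖ) (g : G.obj.obj X) (x : P.obj.obj X),
      (s.app X (τ.vadd X g x) : M.obj.obj X) = i.hom.app X g + (s.app X x : M.obj.obj X)) ∧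
    (∀ (X : Dᵒᵖ) (x : P.obj.obj X), p.hom.app X (s.app X x : M.obj.obj X) = constOne J X) ∧
    ω = hM.extClass

/-- The section over `X` of a sheaf `G` determined by an element of
`H⁰(D, G) = Ext⁰(ℤ, G) = Hom(ℤ, G)`: the image of the section `1` of `ℤ`. -/
noncomputable def sectionOfH0 {G : Sheaf J AddCommGrpCat.{w}} (x : G.H 0) (X : Dᵒᵖ) :
    G.obj.obj X :=
  (Abelian.Ext.addEquiv₀ x).hom.app X (constOne J X)

end Torsors

/-! A derivation on `(U, D)`, like a map `D → B'_U`, is a family of maps of sets `Γ(V, D) → F(V)`,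
natural in `V`, subject to identities that involve at most two sections of `D` at a time. The maps
of sets form a sheaf (`isSheaf_localMaps`), because a section of `D` lifts locally to a member of
the covering. The identities can be checked locally, because two sections lift locally to one and
the same member; this is what lifting finite sets, and not only single sections, is for.

A map to `B'` over `B` is the same as a lifting to `C'` of the composite `D → B → C`. The difference
of two liftings takes values in the kernel of `π` and is a derivation (`exists_sub`); conversely a
lifting plus a derivation is again multiplicative because the ideal has square zero (`exists_vadd`).
Liftings exist locally: as `π` is locally surjective, finite sets of sections of `D` lift locally to
`D ×_B B'`, which maps to `B'` (`locally_exists_hom`).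

The class exists for any torsor `P` under `G`. The group generated by `G` and `P` with the relations
`[g + x] = g + [x]` maps to `ℤ` by the degree, and sheafification gives an extension of `ℤ` by `G`
(`extension_shortExact`). By its universal property it maps to every other extension representing
`P`, with the identity at both ends, so the class is unique (`IsClass.eq_extClass`). The class
vanishes if and only if `1` lifts globally, that is, `P` has a section over a final object
(`IsClass.eq_zero_iff`).

Finally `(T, B_T)` is a final object of `A-Alg(E)/B`, so `H⁰` and the global sections of the torsor
are read off there: they are the derivations of `B` and the liftings of `φ`. -/

namespace AlgOver

variable {E : Type (u + 1)} [LargeCategory.{u} E] {K : GrothendieckTopology E}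
  {A : Sheaf K CommRingCat.{u}} {B : Under A}

/-! ### Maps of sets from `C` to a sheaf, and their descent -/

lemma Hom.naturality_apply {X Y : AlgOver B} (f : Hom X Y) {V W : E} (k : W ⟶ V)
    {v : V ⟶ X.base} {v' : W ⟶ X.base} {w : V ⟶ Y.base} {w' : W ⟶ Y.base} (hv : k ≫ v = v')
    (hw : k ≫ w = w') (h : v ≫ f.base = w) (h' : v' ≫ f.base = w') (c : X.sec v) :
    f.app v' w' h' (X.res k v v' hv c) = Y.res k w w' hw (f.app v w h c) :=
  ConcreteCategory.congr_hom (f.naturality k v v' w w' hv hw h h') c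

lemma Hom.str_app_apply {X Y : AlgOver B} (f : Hom X Y) {V : E} {v : V ⟶ X.base}
    {w : V ⟶ Y.base} (h : v ≫ f.base = w) (a : A.obj.obj (op V)) :
    f.app v w h (X.strAt v a) = Y.strAt w a :=
  ConcreteCategory.congr_hom (f.str_app v w h) a

lemma Hom.app_proj_apply {X Y : AlgOver B} (f : Hom X Y) {V : E} {v : V ⟶ X.base}
    {w : V ⟶ Y.base} (h : v ≫ f.base = w) (c : X.sec v) :
    Y.projAt w (f.app v w h c) = X.projAt v c :=
  ConcreteCategory.congr_hom (f.app_proj v w h) c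

lemma comp_app_apply {X Y Z : AlgOver B} (f : X ⟶ Y) (g : Y ⟶ Z) {V : E} {v : V ⟶ X.base}
    {w : V ⟶ Y.base} {z : V ⟶ Z.base} (hw : v ≫ f.base = w) (hz : w ≫ g.base = z)
    (h : v ≫ (f ≫ g).base = z) (c : X.sec v) :
    Hom.app (f ≫ g) v z h c = g.app w z hz (f.app v w hw c) :=
  ConcreteCategory.congr_hom (comp_app f g v w z hw hz h) c

lemma res_comp_apply (X : AlgOver B) {V W Z : E} (k : W ⟶ V) (l : Z ⟶ W) {v : V ⟶ X.base}
    {w : W ⟶ X.base} {z : Z ⟶ X.base} (h : k ≫ v = w) (h' : l ≫ w = z) (h'' : (l ≫ k) ≫ v = z)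
    (c : X.sec v) : X.res l w z h' (X.res k v w h c) = X.res (l ≫ k) v z h'' c :=
  ConcreteCategory.congr_hom (X.res_comp k l v w z h h') c

lemma res_id_apply (X : AlgOver B) {V : E} {v : V ⟶ X.base} (h : 𝟙 V ≫ v = v) (c : X.sec v) :
    X.res (𝟙 V) v v h c = c :=
  ConcreteCategory.congr_hom (X.res_id v h) c

lemma strAt_res_apply (X : AlgOver B) {V W : E} (k : W ⟶ V) {v : V ⟶ X.base} {w : W ⟶ X.base}
    (h : k ≫ v = w) (a : A.obj.obj (op V)) :
    X.res k v w h (X.strAt v a) = X.strAt w (A.obj.map k.op a) :=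
  ConcreteCategory.congr_hom (X.strAt_res k v w h) a

lemma res_projAt_apply (X : AlgOver B) {V W : E} (k : W ⟶ V) {v : V ⟶ X.base} {w : W ⟶ X.base}
    (h : k ≫ v = w) (c : X.sec v) :
    X.projAt w (X.res k v w h c) = B.right.obj.map k.op (X.projAt v c) :=
  ConcreteCategory.congr_hom (X.res_projAt k v w h) c

/-- The maps of sheaves of sets from `C` to the restriction of `F` to `E/U`, for `X = (U, C)`. -/
structure LocalMap (F : Eᵒᵖ ⥤ Type u) (X : AlgOver B) where
  app {V : E} (v : V ⟶ X.base) : X.sec v → F.obj (op V)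
  naturality {V W : E} (k : W ⟶ V) (v : V ⟶ X.base) (w : W ⟶ X.base) (h : k ≫ v = w)
    (c : X.sec v) : app w (X.res k v w h c) = F.map k.op (app v c)

namespace LocalMap

variable {F : Eᵒᵖ ⥤ Type u} {X Y Z : AlgOver B}

lemma ext' {t t' : LocalMap F X}
    (h : ∀ {V : E} (v : V ⟶ X.base) (c : X.sec v), t.app v c = t'.app v c) : t = t' := by
  obtain ⟨a, _⟩ := t
  obtain ⟨b, _⟩ := t'
  obtain rfl : @a = @b := by
    funext V v c
    exact h v c
  rfl

/-- The pull-back of a local map along a morphism. -/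
def pull (f : X ⟶ Y) (t : LocalMap F Y) : LocalMap F X where
  app v c := t.app (v ≫ f.base) (f.app v (v ≫ f.base) rfl c)
  naturality k v w h c := by
    have h' : k ≫ v ≫ f.base = w ≫ f.base := by rw [← h, Category.assoc]
    rw [← t.naturality k (v ≫ f.base) (w ≫ f.base) h']
    exact congrArg _ (f.naturality_apply k h h' rfl rfl c)

lemma pull_app (f : X ⟶ Y) (t : LocalMap F Y) {V : E} {v : V ⟶ X.base} {w : V ⟶ Y.base}
    (h : v ≫ f.base = w) (c : X.sec v) : (pull f t).app v c = t.app w (f.app v w h c) := by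
  obtain rfl := h
  rfl

end LocalMap

/-- The presheaf of local maps to `F`. -/
def localMaps (B : Under A) (F : Eᵒᵖ ⥤ Type u) : (AlgOver B)ᵒᵖ ⥤ Type (u + 1) where
  obj X := LocalMap F X.unop
  map f := TypeCat.ofHom (LocalMap.pull f.unop)
  map_id X := by
    ext t
    refine LocalMap.ext' fun v c => ?_
    refine (LocalMap.pull_app (𝟙 X.unop) t (Category.comp_id v) c).trans ?_
    exact congrArg _ (X.unop.res_id_apply _ c)
  map_comp {X Y Z} f g := by
    ext t
    refine LocalMap.ext' fun v c => ?_
    have h : v ≫ (g.unop ≫ f.unop).base = (v ≫ g.unop.base) ≫ f.unop.base :=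
      (Category.assoc _ _ _).symm
    refine (LocalMap.pull_app (g.unop ≫ f.unop) t h c).trans ?_
    exact congrArg _ (comp_app_apply g.unop f.unop rfl rfl h c)

/-- This is separatedness of `F` in the form used for every identity below: `Λ` is taken to be the
set of sections occurring in the identity, and one may assume that they all lift to a single member
of `R`. -/
lemma eq_of_lifting {F : Eᵒᵖ ⥤ Type u} (hF : Presieve.IsSheaf K F) {X : AlgOver B} {R : Sieve X}
    (hR : R ∈ topology B X) {V : E} (v : V ⟶ X.base) (Λ : Finset (X.sec v)) {a b : F.obj (op V)}
    (H : ∀ {W : E} (k : W ⟶ V) (Y : AlgOver B) (r : Y ⟶ X) (_ : R r) (w : W ⟶ Y.base)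
      (h : w ≫ r.base = k ≫ v),
      (∀ c ∈ Λ, ∃ y : Y.sec w, r.app w (k ≫ v) h y = X.res k v (k ≫ v) rfl c) →
      F.map k.op a = F.map k.op b) : a = b := by
  refine (hF _ (hR V v Λ)).isSeparatedFor.ext fun W k hk => ?_
  obtain ⟨Y, r, hr, w, h, h'⟩ := hk
  exact H k Y r hr w h h'

namespace LocalMap

variable {F : Eᵒᵖ ⥤ Type u} {X : AlgOver B} {R : Sieve X}

/-- Two local lifts of the same section are the projections of one section of the fibre product,
where compatibility of the family applies. Hence the value at a lift depends only on the section
that is lifted. -/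
lemma compatible_apply {x : Presieve.FamilyOfElements (localMaps B F) (R : Presieve X)}
    (hx : x.Compatible) {Y Z : AlgOver B} {r : Y ⟶ X} {s : Z ⟶ X} (hr : R r) (hs : R s) {W : E}
    {y : W ⟶ Y.base} {z : W ⟶ Z.base} {v : W ⟶ X.base} (hy : y ≫ r.base = v)
    (hz : z ≫ s.base = v) {a : Y.sec y} {b : Z.sec z} (h : r.app y v hy a = s.app z v hz b) :
    LocalMap.app (x r hr) y a = LocalMap.app (x s hs) z b := by
  obtain ⟨P, p, q, hpq, w, hp, hq, H⟩ := exists_fibreProduct r s y z v hy hz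
  obtain ⟨c, rfl, rfl⟩ := H a b h
  rw [← pull_app p (x r hr) hp c, ← pull_app q (x s hs) hq c]
  exact congrArg (fun t : LocalMap F P => t.app w c) (hx p q hr hs hpq)

lemma family_naturality (x : Presieve.FamilyOfElements (localMaps B F) (R : Presieve X))
    {Y : AlgOver B} {r : Y ⟶ X} (hr : R r) {V W : E} (k : W ⟶ V) (v : V ⟶ Y.base) (w : W ⟶ Y.base)
    (h : k ≫ v = w) (c : Y.sec v) :
    LocalMap.app (x r hr) w (Y.res k v w h c) = F.map k.op (LocalMap.app (x r hr) v c) :=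
  LocalMap.naturality _ k v w h c

/-- The value at `c` of the glued map: locally `c` has a lift, and the values at the lifts glue. The
conclusion speaks of all lifts, not of chosen ones, so that naturality and the gluing property can
be read off from it. -/
lemma exists_value (hF : Presieve.IsSheaf K F) (hR : R ∈ topology B X)
    {x : Presieve.FamilyOfElements (localMaps B F) (R : Presieve X)}
    (hx : x.Compatible) {V : E} (v : V ⟶ X.base) (c : X.sec v) :
    ∃ a : F.obj (op V), ∀ {W : E} (k : W ⟶ V) (z : W ⟶ X.base) (hz : k ≫ v = z) (Y : AlgOver B)
      (r : Y ⟶ X) (hr : R r) (w : W ⟶ Y.base) (h : w ≫ r.base = z) (y : Y.sec w),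
      r.app w z h y = X.res k v z hz c → F.map k.op a = LocalMap.app (x r hr) w y := by
  classical
  have H : ∀ {W : E} (k : W ⟶ V) (_ : liftingSieve R v {c} k), ∃ b : F.obj (op W),
      ∃ (Y : AlgOver B) (r : Y ⟶ X) (hr : R r) (w : W ⟶ Y.base) (h : w ≫ r.base = k ≫ v)
        (y : Y.sec w), r.app w (k ≫ v) h y = X.res k v (k ≫ v) rfl c ∧
          b = LocalMap.app (x r hr) w y := by
    rintro W k ⟨Y, r, hr, w, h, H⟩
    obtain ⟨y, hy⟩ := H c (Finset.mem_singleton_self c)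
    exact ⟨_, Y, r, hr, w, h, y, hy, rfl⟩
  -- The lift is chosen for each `k` without any coherence; `compatible_apply` makes the choice
  -- irrelevant.
  let b : Presieve.FamilyOfElements F (liftingSieve R v {c} : Presieve V) :=
    fun W k hk => (H k hk).choose
  have hb : b.Compatible := by
    rw [Presieve.compatible_iff_sieveCompatible]
    intro W W' k l hk
    obtain ⟨Y, r, hr, w, h, y, hy, e⟩ := (H k hk).choose_spec
    obtain ⟨Y', r', hr', w', h', y', hy', e'⟩ :=
      (H (l ≫ k) ((liftingSieve R v {c}).downward_closed hk l)).choose_spec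
    refine e'.trans (Eq.trans ?_ (congrArg (F.map l.op) e).symm)
    rw [← family_naturality x hr l w (l ≫ w) rfl]
    have h₁ : (l ≫ w) ≫ r.base = (l ≫ k) ≫ v := by rw [Category.assoc, h, Category.assoc]
    refine compatible_apply hx hr' hr h' h₁ (hy'.trans ?_)
    have h₂ : l ≫ k ≫ v = (l ≫ k) ≫ v := (Category.assoc _ _ _).symm
    rw [r.naturality_apply l rfl h₂ h, hy, X.res_comp_apply]
  obtain ⟨a, ha, -⟩ := hF _ (hR V v {c}) b hb
  refine ⟨a, fun {W} k z hz Y r hr w h y hy => ?_⟩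
  obtain rfl := hz
  have hk : liftingSieve R v {c} k := ⟨Y, r, hr, w, h, fun d hd => by
    obtain rfl := Finset.mem_singleton.mp hd
    exact ⟨y, hy⟩⟩
  obtain ⟨Y', r', hr', w', h', y', hy', e'⟩ := (H k hk).choose_spec
  exact (ha k hk).trans (e'.trans (compatible_apply hx hr' hr h' h (hy'.trans hy.symm)))

end LocalMap

/-- A map of sets is determined one section at a time, so lifting singletons is enough here. -/
theorem isSheaf_localMaps (B : Under A) {F : Eᵒᵖ ⥤ Type u} (hF : Presieve.IsSheaf K F) :
    Presieve.IsSheaf (topology B) (localMaps B F) := by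
  classical
  intro X R hR x hx
  choose a ha using fun {V : E} (v : V ⟶ X.base) (c : X.sec v) =>
    LocalMap.exists_value hF hR hx v c
  refine ⟨({ app := fun v c => a v c, naturality := fun {V W} k v w h c => ?_ } : LocalMap F X),
    fun Y r hr => ?_, fun t ht => ?_⟩
  · refine eq_of_lifting hF hR w {X.res k v w h c} fun {W'} l Y r hr y hy H => ?_
    obtain ⟨d, hd⟩ := H _ (Finset.mem_singleton_self _)
    rw [ha w _ l (l ≫ w) rfl Y r hr y hy d hd, ← ConcreteCategory.comp_apply, ← F.map_comp,
      ← op_comp]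
    refine (ha v c (l ≫ k) (l ≫ w) (by rw [← h, Category.assoc]) Y r hr y hy d ?_).symm
    rw [hd, X.res_comp_apply]
  · refine LocalMap.ext' fun {V} v c => ?_
    -- Here `c` itself is a lift of its image under `r`, with no further localization: hence `𝟙 V`.
    have := ha (v ≫ r.base) (r.app v (v ≫ r.base) rfl c) (𝟙 V) (v ≫ r.base) (by simp) Y r hr v
      rfl c (X.res_id_apply _ _).symm
    rw [op_id, F.map_id] at this
    exact this
  · refine LocalMap.ext' fun {V} v c => ?_
    refine eq_of_lifting hF hR v {c} fun {W} k Y r hr w h H => ?_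
    obtain ⟨d, hd⟩ := H _ (Finset.mem_singleton_self _)
    refine Eq.trans ?_ (ha v c k (k ≫ v) rfl Y r hr w h d hd).symm
    refine (LocalMap.naturality t k v (k ≫ v) rfl c).symm.trans ?_
    rw [← hd, ← LocalMap.pull_app r t h d]
    exact congrArg (fun t : LocalMap F Y => t.app w d) (ht r hr)

end AlgOver

/-- A subpresheaf of a sheaf whose sections are detected locally is a sheaf. -/
theorem CategoryTheory.Presieve.isSheaf_of_injective {D : Type*} [Category D]
    {J : GrothendieckTopology D} {G F : Dᵒᵖ ⥤ Type u} (hF : Presieve.IsSheaf J F)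
    (ι : G ⟶ F) (hι : ∀ X, Function.Injective (ι.app X))
    (H : ∀ (X : D) (S : Sieve X) (_ : S ∈ J X) (t : F.obj (op X))
      (_ : ∀ ⦃Y : D⦄ (f : Y ⟶ X), S f → ∃ g, ι.app (op Y) g = F.map f.op t),
      ∃ g, ι.app (op X) g = t) : Presieve.IsSheaf J G := by
  intro X S hS x hx
  obtain ⟨t, ht, -⟩ := hF S hS (x.map ι) (hx.map ι)
  obtain ⟨g, rfl⟩ := H X S hS t fun Y f hf => ⟨x f hf, (ht f hf).symm⟩
  refine ⟨g, fun Y f hf => hι _ ?_, fun g' hg' => hι _ ?_⟩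
  · exact (NatTrans.naturality_apply ι f.op g).trans (ht f hf)
  · refine (hF S hS).isSeparatedFor.ext fun Y f hf => ?_
    rw [ht f hf, ← NatTrans.naturality_apply ι f.op g', hg' f hf]
    rfl

/-! ### The sheaf of derivations -/

section

variable {E : Type (u + 1)} [LargeCategory.{u} E] {K : GrothendieckTopology E}
  {A : Sheaf K CommRingCat.{u}} {B C : Under A}

namespace AlgOver

lemma LocalMap.map_app_of_lift {F : Eᵒᵖ ⥤ Type u} {X Y : AlgOver B} (t : LocalMap F X)
    {r : Y ⟶ X} {V W : E} {k : W ⟶ V} {v : V ⟶ X.base} {w : W ⟶ Y.base}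
    (h : w ≫ r.base = k ≫ v) {c : X.sec v} {y : Y.sec w}
    (hy : r.app w (k ≫ v) h y = X.res k v (k ≫ v) rfl c) :
    F.map k.op (t.app v c) = (pull r t).app w y := by
  rw [LocalMap.pull_app r t h, hy, t.naturality]

end AlgOver

open AlgOver

/-- The sheaf of sets underlying a sheaf of modules. -/
noncomputable abbrev AlgModule.types (M : AlgModule C) : Eᵒᵖ ⥤ Type u :=
  M.val.presheaf ⋙ forget AddCommGrpCat.{u}

lemma AlgModule.isSheaf_types (M : AlgModule C) : Presieve.IsSheaf K M.types :=
  have := AddCommGrpCat.adj.{u}.rightAdjoint_preservesLimits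
  (isSheaf_iff_isSheaf_of_type _ _).1 (Presheaf.isSheaf_comp_of_isSheaf K _ _ M.isSheaf)

lemma CommRingCat.isSheaf_types (R : Sheaf K CommRingCat.{u}) :
    Presieve.IsSheaf K (R.obj ⋙ forget CommRingCat.{u}) :=
  have := CommRingCat.adj.{u}.rightAdjoint_preservesLimits
  (isSheaf_iff_isSheaf_of_type _ _).1 (Presheaf.isSheaf_comp_of_isSheaf K _ _ R.property)

lemma AlgModule.map_smul (M : AlgModule C) {V W : E} (k : W ⟶ V) (c : C.right.obj.obj (op V))
    (m : M.val.obj (op V)) :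
    M.val.map k.op (c • m) = (C.right.obj.map k.op c : C.right.obj.obj (op W)) • M.val.map k.op m :=
  PresheafOfModules.map_smul M.val k.op c m

lemma AlgModule.map_add (M : AlgModule C) {V W : E} (k : W ⟶ V) (m n : M.val.obj (op V)) :
    M.val.map k.op (m + n) = M.val.map k.op m + M.val.map k.op n :=
  _root_.map_add (M.val.map k.op).hom m n

lemma CategoryTheory.Under.map_right_app {X Y : Under A} (f : X ⟶ Y) {V W : E} (k : W ⟶ V)
    (x : X.right.obj.obj (op V)) :
    f.right.hom.app (op W) (X.right.obj.map k.op x) = Y.right.obj.map k.op (f.right.hom.app (op V) x) :=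
  ConcreteCategory.congr_hom (f.right.hom.naturality k.op) x

lemma CategoryTheory.Under.right_app_hom {X Y : Under A} (f : X ⟶ Y) {V : E}
    (a : A.obj.obj (op V)) :
    f.right.hom.app (op V) (X.hom.hom.app (op V) a) = Y.hom.hom.app (op V) a :=
  congrArg (fun g : A ⟶ Y.right => g.hom.app (op V) a) (Under.w f)

variable (φ : B ⟶ C) (M : AlgModule C)

/-- A derivation as a local map to the underlying sheaf of sets. -/
noncomputable def LocalDer.toLocalMap :
    derPresheaf φ M ⋙ forget AddCommGrpCat.{u + 1} ⟶ localMaps B M.types where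
  app X := TypeCat.ofHom fun (D : LocalDer φ M X.unop) =>
    ({ app := fun v c => D.app v c
       naturality := fun k v w h c => D.naturality k v w h c } : LocalMap M.types X.unop)

/-- A local map that is a derivation on every member of a covering is a derivation: additivity and
the Leibniz rule involve two sections, and lifting `{c, d}` to one member reduces them to that
member. -/
theorem derPresheaf_isSheaf : Presheaf.IsSheaf (AlgOver.topology B) (derPresheaf φ M) := by
  classical
  refine (Presheaf.isSheaf_iff_isSheaf_forget _ _ (forget AddCommGrpCat.{u + 1})).2
    ((isSheaf_iff_isSheaf_of_type _ _).2 ?_)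
  have hM := M.isSheaf_types
  refine Presieve.isSheaf_of_injective (isSheaf_localMaps B hM) (LocalDer.toLocalMap φ M)
    (fun X D D' h => LocalDer.ext' fun v c =>
      congrArg (fun t : LocalMap M.types X.unop => t.app v c) h) fun X R hR t ht => ?_
  -- The derivation `D` is found before `c` and `y` are given: one `D` serves all the sections that
  -- lift along `w`.
  have key : ∀ {V W : E} (k : W ⟶ V) (v : V ⟶ X.base) (Y : AlgOver B) (r : Y ⟶ X) (_ : R r)
      (w : W ⟶ Y.base) (h : w ≫ r.base = k ≫ v), ∃ D : LocalDer φ M Y, ∀ (c : X.sec v)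
      (y : Y.sec w), r.app w (k ≫ v) h y = X.res k v (k ≫ v) rfl c →
        M.val.map k.op (LocalMap.app t v c) = D.app w y := by
    intro V W k v Y r hr w h
    obtain ⟨D, hD⟩ := ht r hr
    refine ⟨D, fun c y hy => (LocalMap.map_app_of_lift t h hy).trans ?_⟩
    exact (congrArg (fun t : LocalMap M.types Y => t.app w y) hD).symm
  have hadd : ∀ {V : E} (v : V ⟶ X.base) (c d : X.sec v),
      (LocalMap.app t v (c + d) : M.val.obj (op V)) =
        (LocalMap.app t v c : M.val.obj (op V)) + (LocalMap.app t v d : M.val.obj (op V)) := by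
    intro V v c d
    refine eq_of_lifting hM hR v {c, d} fun {W} k Y r hr w h H => ?_
    obtain ⟨y, hy⟩ := H c (by simp)
    obtain ⟨z, hz⟩ := H d (by simp)
    obtain ⟨D, hD⟩ := key k v Y r hr w h
    refine (hD (c + d) (y + z) (by rw [map_add, map_add, hy, hz])).trans ?_
    refine Eq.trans ?_ (M.map_add k _ _).symm
    rw [hD c y hy, hD d z hz, map_add]
    rfl
  refine ⟨({ app := fun {V} v => AddMonoidHom.mk' (LocalMap.app t v) (hadd v)
             naturality := fun k v w h c => LocalMap.naturality t k v w h c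
             leibniz := fun {V} v c d => ?_
             app_str := fun {V} v a => ?_ } : LocalDer φ M X), rfl⟩
  · refine eq_of_lifting hM hR v {c, d} fun {W} k Y r hr w h H => ?_
    obtain ⟨y, hy⟩ := H c (by simp)
    obtain ⟨z, hz⟩ := H d (by simp)
    obtain ⟨D, hD⟩ := key k v Y r hr w h
    -- A section and its lift have the same image in `B`, so they act in the same way on `M`.
    have hp : ∀ (c : X.sec v) (y : Y.sec w), r.app w (k ≫ v) h y = X.res k v (k ≫ v) rfl c →
        C.right.obj.map k.op (φ.right.hom.app (op V) (X.projAt v c)) =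
          φ.right.hom.app (op W) (Y.projAt w y) := by
      intro c y hy
      rw [← Under.map_right_app, ← X.res_projAt_apply k rfl, ← hy, r.app_proj_apply]
    refine (hD (c * d) (y * z) (by rw [map_mul, map_mul, hy, hz])).trans ?_
    refine Eq.trans ?_ (M.map_add k _ _).symm
    rw [D.leibniz, M.map_smul, M.map_smul, hp c y hy, hp d z hz, ← hD c y hy, ← hD d z hz]
    rfl
  -- Sections coming from `A` lift to every member through the structure map, so nothing has to be
  -- lifted and `Λ` is empty.
  · refine eq_of_lifting hM hR v ∅ fun {W} k Y r hr w h H => ?_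
    obtain ⟨D, hD⟩ := key k v Y r hr w h
    refine (hD (X.strAt v a) (Y.strAt w (A.obj.map k.op a)) ?_).trans ?_
    · rw [r.str_app_apply, X.strAt_res_apply]
    · rw [D.app_str]
      exact (map_zero (M.val.map k.op).hom).symm

end

/-! ### The presheaf represented by `B'` is a sheaf -/

section

variable {E : Type (u + 1)} [LargeCategory.{u} E] {K : GrothendieckTopology E}
  {A : Sheaf K CommRingCat.{u}} {B B' : Under A}

namespace AlgOver

section ToUnder

variable {q : B' ⟶ B} {T : E} {X Y : AlgOver B}

/-- The ring homomorphisms `Γ(V, C) → Γ(V, B')` defined by a morphism `(U, C) ⟶ (T, B')`. -/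
def toUnder (ψ : X ⟶ ofUnder T q) {V : E} (v : V ⟶ X.base) :
    X.sec v →+* B'.right.obj.obj (op V) :=
  (ψ.app v (v ≫ ψ.base) rfl).hom

/-- The sections of `(T, B'_T)` over `w : V ⟶ T` are `B'(V)` whatever `w` is, so the map to `T` can
be dropped from the notation. -/
lemma app_eq_toUnder (ψ : X ⟶ ofUnder T q) {V : E} {v : V ⟶ X.base} {w : V ⟶ T}
    (h : v ≫ ψ.base = w) (c : X.sec v) :
    (ψ.app v w h c : B'.right.obj.obj (op V)) = toUnder ψ v c := by
  subst h
  rfl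

lemma toUnder_res (ψ : X ⟶ ofUnder T q) {V W : E} (k : W ⟶ V) (v : V ⟶ X.base) (w : W ⟶ X.base)
    (h : k ≫ v = w) (c : X.sec v) :
    toUnder ψ w (X.res k v w h c) = B'.right.obj.map k.op (toUnder ψ v c) :=
  ψ.naturality_apply k h (by rw [← h, Category.assoc]) rfl rfl c

lemma toUnder_strAt (ψ : X ⟶ ofUnder T q) {V : E} (v : V ⟶ X.base) (a : A.obj.obj (op V)) :
    toUnder ψ v (X.strAt v a) = B'.hom.hom.app (op V) a :=
  ψ.str_app_apply rfl a

lemma toUnder_projAt (ψ : X ⟶ ofUnder T q) {V : E} (v : V ⟶ X.base) (c : X.sec v) :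
    q.right.hom.app (op V) (toUnder ψ v c) = X.projAt v c :=
  ψ.app_proj_apply rfl c

lemma toUnder_comp (f : Y ⟶ X) (ψ : X ⟶ ofUnder T q) {V : E} {v : V ⟶ Y.base} {w : V ⟶ X.base}
    (h : v ≫ f.base = w) (c : Y.sec v) :
    toUnder (f ≫ ψ) v c = toUnder ψ w (f.app v w h c) := by
  subst h
  exact comp_app_apply f ψ rfl (Category.assoc _ _ _) rfl c |>.trans (app_eq_toUnder ψ _ _)

lemma hom_ofUnder_ext (hT : IsTerminal T) {ψ ψ' : X ⟶ ofUnder T q}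
    (h : ∀ {V : E} (v : V ⟶ X.base) (c : X.sec v), toUnder ψ v c = toUnder ψ' v c) : ψ = ψ' := by
  refine Hom.ext' (hT.hom_ext _ _) fun v w hf hg => ?_
  ext c
  exact (app_eq_toUnder ψ hf c).trans ((h v c).trans (app_eq_toUnder ψ' hg c).symm)

/-- A morphism `(U, C) ⟶ (T, B')` defined by ring homomorphisms `Γ(V, C) → Γ(V, B')`. -/
def homOfUnder (hT : IsTerminal T) (f : ∀ {V : E} (v : V ⟶ X.base),
      X.sec v →+* B'.right.obj.obj (op V))
    (hf : ∀ {V W : E} (k : W ⟶ V) (v : V ⟶ X.base) (w : W ⟶ X.base) (h : k ≫ v = w) (c : X.sec v),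
      f w (X.res k v w h c) = B'.right.obj.map k.op (f v c))
    (hs : ∀ {V : E} (v : V ⟶ X.base) (a : A.obj.obj (op V)),
      f v (X.strAt v a) = B'.hom.hom.app (op V) a)
    (hq : ∀ {V : E} (v : V ⟶ X.base) (c : X.sec v),
      q.right.hom.app (op V) (f v c) = X.projAt v c) : X ⟶ ofUnder T q where
  base := hT.from X.base
  app v w h := CommRingCat.ofHom (f v)
  naturality k v v' w w' hv hw h h' := by
    ext c
    exact hf k v v' hv c
  str_app v w h := by
    ext a
    exact hs v a
  app_proj v w h := by
    ext c
    exact hq v c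

/-- A morphism `(U, C) ⟶ (T, B')` as a local map. -/
def toUnderLocalMap (q : B' ⟶ B) (T : E) :
    yoneda.obj (ofUnder T q) ⟶ localMaps B (B'.right.obj ⋙ forget CommRingCat.{u}) where
  app X := TypeCat.ofHom fun (ψ : X.unop ⟶ ofUnder T q) =>
    ({ app := fun v c => toUnder ψ v c
       naturality := fun k v w h c => toUnder_res ψ k v w h c } :
      LocalMap (B'.right.obj ⋙ forget CommRingCat.{u}) X.unop)
  naturality X Y f := by
    ext ψ
    exact LocalMap.ext' fun v c => toUnder_comp f.unop ψ rfl c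

end ToUnder

/-- As for derivations: the ring axioms and the compatibilities with `A` and `B` involve at most two
sections at a time, hence are local. -/
theorem isSheaf_yoneda_ofUnder (q : B' ⟶ B) {T : E} (hT : IsTerminal T) :
    Presheaf.IsSheaf (topology B) (yoneda.obj (ofUnder T q)) := by
  classical
  refine (isSheaf_iff_isSheaf_of_type _ _).2 ?_
  have hB' := CommRingCat.isSheaf_types B'.right
  have hB := CommRingCat.isSheaf_types B.right
  refine Presieve.isSheaf_of_injective (isSheaf_localMaps B hB') (toUnderLocalMap q T)
    (fun X ψ ψ' h => hom_ofUnder_ext hT fun v c =>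
      congrArg (fun t : LocalMap _ X.unop => t.app v c) h) fun X R hR t ht => ?_
  have key : ∀ {V W : E} (k : W ⟶ V) (v : V ⟶ X.base) (Y : AlgOver B) (r : Y ⟶ X) (_ : R r)
      (w : W ⟶ Y.base) (h : w ≫ r.base = k ≫ v), ∃ ψ : Y ⟶ ofUnder T q, ∀ (c : X.sec v)
      (y : Y.sec w), r.app w (k ≫ v) h y = X.res k v (k ≫ v) rfl c →
        B'.right.obj.map k.op (LocalMap.app t v c) = toUnder ψ w y := by
    intro V W k v Y r hr w h
    obtain ⟨ψ, hψ⟩ := ht r hr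
    refine ⟨ψ, fun c y hy => (LocalMap.map_app_of_lift t h hy).trans ?_⟩
    exact (congrArg (fun t : LocalMap _ Y => t.app w y) hψ).symm
  let f : ∀ {V : E} (v : V ⟶ X.base), X.sec v →+* B'.right.obj.obj (op V) := fun {V} v =>
    { toFun := LocalMap.app t v
      map_one' := by
        refine eq_of_lifting hB' hR v ∅ fun {W} k Y r hr w h H => ?_
        obtain ⟨ψ, hψ⟩ := key k v Y r hr w h
        refine (hψ 1 1 (by rw [map_one, map_one])).trans ?_
        rw [map_one]
        exact (map_one (B'.right.obj.map k.op).hom).symm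
      map_zero' := by
        refine eq_of_lifting hB' hR v ∅ fun {W} k Y r hr w h H => ?_
        obtain ⟨ψ, hψ⟩ := key k v Y r hr w h
        refine (hψ 0 0 (by rw [map_zero, map_zero])).trans ?_
        rw [map_zero]
        exact (map_zero (B'.right.obj.map k.op).hom).symm
      map_add' := fun c d => by
        refine eq_of_lifting hB' hR v {c, d} fun {W} k Y r hr w h H => ?_
        obtain ⟨y, hy⟩ := H c (by simp)
        obtain ⟨z, hz⟩ := H d (by simp)
        obtain ⟨ψ, hψ⟩ := key k v Y r hr w h
        refine (hψ (c + d) (y + z) (by rw [map_add, map_add, hy, hz])).trans ?_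
        refine Eq.trans ?_ (map_add (B'.right.obj.map k.op).hom _ _).symm
        rw [map_add, ← hψ c y hy, ← hψ d z hz]
      map_mul' := fun c d => by
        refine eq_of_lifting hB' hR v {c, d} fun {W} k Y r hr w h H => ?_
        obtain ⟨y, hy⟩ := H c (by simp)
        obtain ⟨z, hz⟩ := H d (by simp)
        obtain ⟨ψ, hψ⟩ := key k v Y r hr w h
        refine (hψ (c * d) (y * z) (by rw [map_mul, map_mul, hy, hz])).trans ?_
        refine Eq.trans ?_ (map_mul (B'.right.obj.map k.op).hom _ _).symm
        rw [map_mul, ← hψ c y hy, ← hψ d z hz] }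
  refine ⟨homOfUnder hT f (fun k v w h c => LocalMap.naturality t k v w h c)
    (fun {V} v a => ?_) (fun {V} v c => ?_), rfl⟩
  · refine eq_of_lifting hB' hR v ∅ fun {W} k Y r hr w h H => ?_
    obtain ⟨ψ, hψ⟩ := key k v Y r hr w h
    refine (hψ (X.strAt v a) (Y.strAt w (A.obj.map k.op a)) ?_).trans ?_
    · rw [r.str_app_apply, X.strAt_res_apply]
    · rw [toUnder_strAt]
      exact ConcreteCategory.congr_hom (B'.hom.hom.naturality k.op) a
  -- This identity takes place in `B`, so the separatedness used is that of `B` and not of `B'`.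
  · refine eq_of_lifting hB hR v {c} fun {W} k Y r hr w h H => ?_
    obtain ⟨y, hy⟩ := H c (by simp)
    obtain ⟨ψ, hψ⟩ := key k v Y r hr w h
    refine (Under.map_right_app q k (f v c)).symm.trans ?_
    refine (congrArg (q.right.hom.app (op W)) (hψ c y hy)).trans ?_
    refine (toUnder_projAt ψ w y).trans ?_
    rw [← r.app_proj_apply h, hy]
    exact X.res_projAt_apply k rfl c

end AlgOver

end

/-! ### Morphisms to `B'` as liftings to `C'`; the torsor property -/

section

variable {E : Type (u + 1)} [LargeCategory.{u} E] {K : GrothendieckTopology E}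
  {A : Sheaf K CommRingCat.{u}} {B C C' B' : Under A}

namespace AlgOver

/-- The unique morphism to `(T, B_T)`, where `T` is the final object of `E`. -/
def toFinal {T : E} (hT : IsTerminal T) (X : AlgOver B) : X ⟶ ofUnder T (𝟙 B) :=
  homOfUnder hT (fun v => (X.projAt v).hom) (fun k _ _ h c => X.res_projAt_apply k h c)
    (fun v a => ConcreteCategory.congr_hom (X.strAt_projAt v) a) fun _ _ => rfl

/-- `(T, B_T)` is a final object, where `T` is the final object of `E`. -/
def isTerminalOfUnder {T : E} (hT : IsTerminal T) (B : Under A) :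
    IsTerminal (ofUnder T (𝟙 B)) :=
  IsTerminal.ofUniqueHom (toFinal hT) fun _ m =>
    hom_ofUnder_ext hT fun v c => toUnder_projAt m v c

section Lifts

variable {π : C' ⟶ C} {φ : B ⟶ C} {p : B' ⟶ C'} {q : B' ⟶ B} (hB' : IsPullback p q π φ)
  {T : E} (hT : IsTerminal T)

include hB'

/-- Fibre products of `A`-algebras are computed in sheaves of rings and then on sections, so a
section of `B'` is a pair of sections of `C'` and `B` with the same image in `C`. -/
lemma isPullback_sections (V : E) :
    IsPullback ((forget CommRingCat.{u}).map (p.right.hom.app (op V)))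
      ((forget CommRingCat.{u}).map (q.right.hom.app (op V)))
      ((forget CommRingCat.{u}).map (π.right.hom.app (op V)))
      ((forget CommRingCat.{u}).map (φ.right.hom.app (op V))) :=
  hB'.map (Under.forget A ⋙ sheafToPresheaf K CommRingCat.{u} ⋙ (evaluation _ _).obj (op V) ⋙
    forget CommRingCat.{u})

lemma sections_ext {V : E} {x y : B'.right.obj.obj (op V)}
    (h₁ : p.right.hom.app (op V) x = p.right.hom.app (op V) y)
    (h₂ : q.right.hom.app (op V) x = q.right.hom.app (op V) y) : x = y :=
  Types.ext_of_isPullback (isPullback_sections hB' V) h₁ h₂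

lemma exists_section {V : E} {x : C'.right.obj.obj (op V)} {b : B.right.obj.obj (op V)}
    (h : π.right.hom.app (op V) x = φ.right.hom.app (op V) b) :
    ∃ y, p.right.hom.app (op V) y = x ∧ q.right.hom.app (op V) y = b :=
  Types.exists_of_isPullback (isPullback_sections hB' V) x b h

omit hB'

/-- The homomorphisms to `C'` defined by a morphism `(U, D) ⟶ (T, B')`. -/
def toLift (p : B' ⟶ C') {X : AlgOver B} (ψ : X ⟶ ofUnder T q) {V : E} (v : V ⟶ X.base) :
    X.sec v →+* C'.right.obj.obj (op V) :=
  (p.right.hom.app (op V)).hom.comp (toUnder ψ v)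

lemma toLift_res (p : B' ⟶ C') {X : AlgOver B} (ψ : X ⟶ ofUnder T q) {V W : E} (k : W ⟶ V)
    (v : V ⟶ X.base) (w : W ⟶ X.base) (h : k ≫ v = w) (c : X.sec v) :
    toLift p ψ w (X.res k v w h c) = C'.right.obj.map k.op (toLift p ψ v c) :=
  (congrArg _ (toUnder_res ψ k v w h c)).trans (Under.map_right_app p k _)

lemma toLift_strAt (p : B' ⟶ C') {X : AlgOver B} (ψ : X ⟶ ofUnder T q) {V : E} (v : V ⟶ X.base)
    (a : A.obj.obj (op V)) : toLift p ψ v (X.strAt v a) = C'.hom.hom.app (op V) a :=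
  (congrArg _ (toUnder_strAt ψ v a)).trans (Under.right_app_hom p a)

lemma toLift_comp (p : B' ⟶ C') {X Y : AlgOver B} (f : Y ⟶ X) (ψ : X ⟶ ofUnder T q) {V : E}
    {v : V ⟶ Y.base} {w : V ⟶ X.base} (h : v ≫ f.base = w) (c : Y.sec v) :
    toLift p (f ≫ ψ) v c = toLift p ψ w (f.app v w h c) :=
  congrArg _ (toUnder_comp f ψ h c)

include hB'

lemma toLift_proj {X : AlgOver B} (ψ : X ⟶ ofUnder T q) {V : E} (v : V ⟶ X.base) (c : X.sec v) :
    π.right.hom.app (op V) (toLift p ψ v c) = φ.right.hom.app (op V) (X.projAt v c) := by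
  rw [← toUnder_projAt ψ v c]
  exact congrArg (fun g : B' ⟶ C => g.right.hom.app (op V) (toUnder ψ v c)) hB'.w

include hT in
lemma hom_ext_toLift {X : AlgOver B} {ψ ψ' : X ⟶ ofUnder T q}
    (h : ∀ {V : E} (v : V ⟶ X.base) (c : X.sec v), toLift p ψ v c = toLift p ψ' v c) : ψ = ψ' :=
  hom_ofUnder_ext hT fun v c => sections_ext hB' (h v c)
    ((toUnder_projAt ψ v c).trans (toUnder_projAt ψ' v c).symm)

include hT in
-- The component in `B` of a morphism to `B'` over `B` is forced to be the projection of `X`, so the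
-- component in `C'` can be prescribed freely above it.
lemma exists_hom_toLift {X : AlgOver B}
    (g : ∀ {V : E} (v : V ⟶ X.base), X.sec v →+* C'.right.obj.obj (op V))
    (hg : ∀ {V W : E} (k : W ⟶ V) (v : V ⟶ X.base) (w : W ⟶ X.base) (h : k ≫ v = w) (c : X.sec v),
      g w (X.res k v w h c) = C'.right.obj.map k.op (g v c))
    (hs : ∀ {V : E} (v : V ⟶ X.base) (a : A.obj.obj (op V)),
      g v (X.strAt v a) = C'.hom.hom.app (op V) a)
    (hπ : ∀ {V : E} (v : V ⟶ X.base) (c : X.sec v),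
      π.right.hom.app (op V) (g v c) = φ.right.hom.app (op V) (X.projAt v c)) :
    ∃ ψ : X ⟶ ofUnder T q, ∀ {V : E} (v : V ⟶ X.base) (c : X.sec v), toLift p ψ v c = g v c := by
  choose f hp hq using fun {V : E} (v : V ⟶ X.base) (c : X.sec v) => exists_section hB' (hπ v c)
  let F : ∀ {V : E} (v : V ⟶ X.base), X.sec v →+* B'.right.obj.obj (op V) := fun v =>
    { toFun := f v
      map_one' := sections_ext hB' (by rw [hp, map_one, map_one]) (by rw [hq, map_one, map_one])
      map_zero' := sections_ext hB' (by rw [hp, map_zero, map_zero])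
        (by rw [hq, map_zero, map_zero])
      map_add' := fun c d => sections_ext hB' (by rw [hp, map_add, map_add, hp, hp])
        (by rw [hq, map_add, map_add, hq, hq])
      map_mul' := fun c d => sections_ext hB' (by rw [hp, map_mul, map_mul, hp, hp])
        (by rw [hq, map_mul, map_mul, hq, hq]) }
  refine ⟨homOfUnder hT F (fun k v w h c => sections_ext hB' ?_ ?_)
    (fun v a => sections_ext hB' ?_ ?_) hq, hp⟩
  · rw [Under.map_right_app p]
    exact (hp w _).trans ((hg k v w h c).trans (congrArg _ (hp v c).symm))
  · rw [Under.map_right_app q]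
    exact (hq w _).trans ((X.res_projAt_apply k h c).trans (congrArg _ (hq v c).symm))
  · exact (hp v _).trans ((hs v a).trans (Under.right_app_hom p a).symm)
  · refine (hq v _).trans (Eq.trans ?_ (Under.right_app_hom q a).symm)
    exact ConcreteCategory.congr_hom (X.strAt_projAt v) a

variable {M : AlgModule C} (S : SquareZeroExtension π M)

include hT in
lemma exists_vadd {X : AlgOver B} (D : LocalDer φ M X) (ψ : X ⟶ ofUnder T q) :
    ∃ ψ' : X ⟶ ofUnder T q, ∀ {V : E} (v : V ⟶ X.base) (c : X.sec v),
      toLift p ψ' v c = S.incl (op V) (D.app v c) + toLift p ψ v c := by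
  refine exists_hom_toLift hB' hT (fun {V} v => RingHom.mk' (MonoidHom.mk (OneHom.mk
    (fun c => S.incl (op V) (D.app v c) + toLift p ψ v c) ?_) ?_) ?_) ?_ ?_ ?_
  · have h : D.app v 1 = 0 := by
      have := D.app_str v 1
      rwa [map_one] at this
    rw [h, map_zero, map_one, zero_add]
  · intro c d
    change S.incl (op V) (D.app v (c * d)) + toLift p ψ v (c * d) =
      (S.incl (op V) (D.app v c) + toLift p ψ v c) * (S.incl (op V) (D.app v d) + toLift p ψ v d)
    rw [D.leibniz, map_add, map_mul, ← toLift_proj hB' ψ, ← toLift_proj hB' ψ, S.linear, S.linear]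
    -- Leibniz and linearity account for the two cross terms; the product of the two increments is
    -- the only term left.
    linear_combination - S.square_zero (op V) (D.app v c) (D.app v d)
  · intro c d
    change S.incl (op V) (D.app v (c + d)) + toLift p ψ v (c + d) =
      (S.incl (op V) (D.app v c) + toLift p ψ v c) + (S.incl (op V) (D.app v d) + toLift p ψ v d)
    rw [map_add, map_add, map_add]
    abel
  · intro V W k v w h c
    change S.incl (op W) (D.app w (X.res k v w h c)) + toLift p ψ w (X.res k v w h c) =
      C'.right.obj.map k.op (S.incl (op V) (D.app v c) + toLift p ψ v c)
    rw [D.naturality, toLift_res, S.naturality, map_add]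
  · intro V v a
    change S.incl (op V) (D.app v (X.strAt v a)) + toLift p ψ v (X.strAt v a) = _
    rw [D.app_str, map_zero, zero_add, toLift_strAt]
  · intro V v c
    change π.right.hom.app (op V) (S.incl (op V) (D.app v c) + toLift p ψ v c) = _
    rw [map_add, (S.exact (op V) _).2 ⟨_, rfl⟩, zero_add, toLift_proj hB']

lemma exists_sub {X : AlgOver B} (ψ ψ' : X ⟶ ofUnder T q) :
    ∃ D : LocalDer φ M X, ∀ {V : E} (v : V ⟶ X.base) (c : X.sec v),
      toLift p ψ' v c = S.incl (op V) (D.app v c) + toLift p ψ v c := by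
  have H : ∀ {V : E} (v : V ⟶ X.base) (c : X.sec v),
      ∃ m, S.incl (op V) m = toLift p ψ' v c - toLift p ψ v c := fun {V} v c =>
    (S.exact (op V) _).1 (by rw [map_sub, toLift_proj hB', toLift_proj hB', sub_self])
  choose d hd using @H
  refine ⟨({ app := fun {V} v => AddMonoidHom.mk' (@d V v) fun c c' => S.injective _ ?_
             naturality := fun {V W} k v w h c => S.injective _ ?_
             leibniz := fun {V} v c c' => S.injective _ ?_
             app_str := fun {V} v a => S.injective _ ?_ } : LocalDer φ M X), fun v c => ?_⟩
  · rw [map_add, hd, hd, hd, map_add, map_add]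
    abel
  · refine (hd w _).trans ?_
    rw [S.naturality, toLift_res, toLift_res, ← map_sub]
    exact congrArg _ (hd v c).symm
  · refine (hd v _).trans ?_
    -- The image of `c` in `C` is written through `ψ` and that of `c'` through `ψ'`. With this mixed
    -- choice the Leibniz rule becomes the ring identity `x'y' - xy = x(y' - y) + y'(x' - x)`.
    rw [map_add, ← toLift_proj hB' ψ, ← toLift_proj hB' ψ', S.linear, S.linear]
    refine Eq.trans ?_ (congrArg₂ (fun x y => toLift p ψ v c * x + toLift p ψ' v c' * y)
      (hd v c') (hd v c)).symm
    rw [map_mul, map_mul]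
    ring
  · refine (hd v _).trans ?_
    rw [toLift_strAt, toLift_strAt, sub_self, map_zero]
  · exact (eq_sub_iff_add_eq.1 (hd v c)).symm

include S hT in
lemma locally_exists_hom (X : AlgOver B) :
    ∃ R ∈ topology B X, ∀ ⦃Y : AlgOver B⦄ (f : Y ⟶ X), R f → Nonempty (Y ⟶ ofUnder T q) := by
  classical
  refine ⟨{ arrows := fun Y _ => Nonempty (Y ⟶ ofUnder T q)
            downward_closed := fun ⟨h⟩ g => ⟨g ≫ h⟩ }, fun V v Λ => ?_, fun Y f h => h⟩
  let I : X.sec v → Sieve V := fun c =>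
    Presheaf.imageSieve π.right.hom (φ.right.hom.app (op V) (X.projAt v c))
  have hI : Λ.inf I ∈ K V := Finset.inf_induction (K.top_mem V)
    (fun _ h₁ _ h₂ => K.intersection_covering h₁ h₂)
    fun c _ => S.locally_surjective.imageSieve_mem _
  refine K.superset_covering (fun W k hk => ?_) hI
  -- The fibre product over the final object `(T, B_T)` is `D ×_B B'`, restricted to `W`.
  obtain ⟨P, a, b, -, w, ha, hb, H⟩ := exists_fibreProduct (toFinal hT X)
    (toFinal hT (ofUnder T q)) (k ≫ v) (hT.from W) (hT.from W) (hT.hom_ext _ _) (hT.hom_ext _ _)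
  refine ⟨P, a, ⟨b⟩, w, ha, fun c hc => ?_⟩
  have hle : Λ.inf I ≤ I c := Finset.inf_le hc
  obtain ⟨x, hx⟩ := hle _ hk
  obtain ⟨y, -, hy⟩ := exists_section hB' (b := B.right.obj.map k.op (X.projAt v c))
    (hx.trans (Under.map_right_app φ k _).symm)
  obtain ⟨z, hz, -⟩ := H (X.res k v (k ≫ v) rfl c) y
    ((X.res_projAt_apply k rfl c).trans hy.symm)
  exact ⟨z, hz⟩

end Lifts

end AlgOver

end

/-! ### The constant sheaf `ℤ`, `H⁰`, and split extensions -/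

section

universe w

variable {D : Type w} [SmallCategory.{w} D] {J : GrothendieckTopology D}

lemma constInt_hom_ext {H : Sheaf J AddCommGrpCat.{w}} {f g : constInt J ⟶ H}
    (h : ∀ X, f.hom.app X (constOne J X) = g.hom.app X (constOne J X)) : f = g := by
  refine Sheaf.hom_ext (sheafify_hom_ext J _ _ H.property ?_)
  ext X n
  have e : n = (n : ULift.{w} ℤ).down • (ULift.up 1 : ULift.{w} ℤ) :=
    ULift.ext _ _ (by simp)
  rw [e, map_zsmul, map_zsmul]
  exact congrArg _ (h X)

/-- Together with `constInt_hom_ext`, this identifies the maps from `ℤ` with the compatible families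
of sections, each map being given by the images of `1`. -/
lemma exists_constInt_hom (H : Sheaf J AddCommGrpCat.{w}) (z : ∀ X : Dᵒᵖ, H.obj.obj X)
    (hz : ∀ {X Y : Dᵒᵖ} (f : X ⟶ Y), H.obj.map f (z X) = z Y) :
    ∃ f : constInt J ⟶ H, ∀ X, f.hom.app X (constOne J X) = z X := by
  let f₀ : (Functor.const Dᵒᵖ).obj (AddCommGrpCat.of (ULift.{w} ℤ)) ⟶ H.obj :=
    { app := fun X => AddCommGrpCat.ofHom
        ((zmultiplesHom _ (z X)).comp AddEquiv.ulift.toAddMonoidHom)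
      naturality := fun X Y f => by
        ext n
        change n.down • z Y = H.obj.map f (n.down • z X)
        rw [map_zsmul, hz] }
  refine ⟨⟨sheafifyLift J f₀ H.property⟩, fun X => ?_⟩
  refine (ConcreteCategory.congr_hom (NatTrans.congr_app
    (toSheafify_sheafifyLift J f₀ H.property) X) (ULift.up 1)).trans ?_
  exact one_zsmul _

lemma map_constOne {X Y : Dᵒᵖ} (f : X ⟶ Y) :
    (constInt J).obj.map f (constOne J X) = constOne J Y :=
  (ConcreteCategory.congr_hom ((toSheafify J ((Functor.const Dᵒᵖ).obj
    (AddCommGrpCat.of (ULift.{w} ℤ)))).naturality f) (ULift.up 1)).symm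

lemma map_sectionOfH0 {G : Sheaf J AddCommGrpCat.{w}} (x : G.H 0) {X Y : Dᵒᵖ} (f : X ⟶ Y) :
    G.obj.map f (sectionOfH0 x X) = sectionOfH0 x Y := by
  refine (ConcreteCategory.congr_hom ((Abelian.Ext.addEquiv₀ x).hom.naturality f) _).symm.trans ?_
  exact congrArg _ (map_constOne f)

lemma sectionOfH0_add {G : Sheaf J AddCommGrpCat.{w}} (x y : G.H 0) (X : Dᵒᵖ) :
    sectionOfH0 (x + y) X = sectionOfH0 x X + sectionOfH0 y X := by
  simp only [sectionOfH0, map_add]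
  rfl

/-- `H⁰` is the group of sections over a final object. -/
noncomputable def sectionsH0 (G : Sheaf J AddCommGrpCat.{w}) {X₀ : D} (h₀ : IsTerminal X₀) :
    G.H 0 ≃+ G.obj.obj (op X₀) :=
  AddEquiv.ofBijective (AddMonoidHom.mk' (fun x => sectionOfH0 x (op X₀))
    fun x y => sectionOfH0_add x y _) <| by
    refine ⟨fun x y h => ?_, fun z => ?_⟩
    · refine Abelian.Ext.addEquiv₀.injective (constInt_hom_ext fun X => ?_)
      change sectionOfH0 x X = sectionOfH0 y X
      rw [← map_sectionOfH0 x (h₀.from X.unop).op, ← map_sectionOfH0 y (h₀.from X.unop).op]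
      exact congrArg _ h
    · obtain ⟨f, hf⟩ := exists_constInt_hom G (fun X => G.obj.map (h₀.from X.unop).op z)
        fun {X Y} g => by
          rw [← ConcreteCategory.comp_apply, ← G.obj.map_comp]
          congr 3
          exact Quiver.Hom.unop_inj (h₀.hom_ext _ _)
      refine ⟨Abelian.Ext.addEquiv₀.symm f, ?_⟩
      change (Abelian.Ext.addEquiv₀ (Abelian.Ext.addEquiv₀.symm f)).hom.app _ _ = z
      rw [AddEquiv.apply_symm_apply, hf, h₀.hom_ext (h₀.from _) (𝟙 X₀), op_id, G.obj.map_id]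
      rfl

/-- The class is the image of the identity of `S.X₃` under the connecting map of the long exact
sequence, so it vanishes exactly when the identity lifts to `S.X₂`. -/
lemma CategoryTheory.ShortComplex.ShortExact.extClass_eq_zero_iff {𝒜 : Type*} [Category 𝒜]
    [Abelian 𝒜] [HasExt.{w} 𝒜] {S : ShortComplex 𝒜} (hS : S.ShortExact) :
    hS.extClass = 0 ↔ ∃ σ : S.X₃ ⟶ S.X₂, σ ≫ S.g = 𝟙 _ := by
  refine ⟨fun h => ?_, fun ⟨σ, hσ⟩ => ?_⟩
  · obtain ⟨x, hx⟩ := Abelian.Ext.covariant_sequence_exact₃ S.X₃ hS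
      (Abelian.Ext.mk₀ (𝟙 S.X₃)) (zero_add 1) (by rw [h, Abelian.Ext.comp_zero])
    obtain ⟨σ, rfl⟩ := (Abelian.Ext.mk₀_bijective _ _).2 x
    rw [Abelian.Ext.mk₀_comp_mk₀] at hx
    exact ⟨σ, (Abelian.Ext.mk₀_bijective _ _).1 hx⟩
  · rw [← Abelian.Ext.mk₀_id_comp hS.extClass, ← hσ, ← Abelian.Ext.mk₀_comp_mk₀_assoc,
      hS.comp_extClass, Abelian.Ext.comp_zero]

lemma sections_injective {S : ShortComplex (Sheaf J AddCommGrpCat.{w})} (hS : S.ShortExact)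
    (X : Dᵒᵖ) : Function.Injective (S.f.hom.app X) := by
  have := hS.mono_f
  have : Mono (((sheafToPresheaf J AddCommGrpCat.{w}) ⋙ (evaluation _ _).obj X).map S.f) :=
    inferInstance
  exact (AddCommGrpCat.mono_iff_injective _).1 this

lemma sections_exact {S : ShortComplex (Sheaf J AddCommGrpCat.{w})} (hS : S.ShortExact)
    (X : Dᵒᵖ) (m : S.X₂.obj.obj X) (hm : S.g.hom.app X m = 0) : ∃ g, S.f.hom.app X g = m := by
  have := hS.mono_f
  exact (ShortComplex.ab_exact_iff _).1 (hS.exact.map_of_mono_of_preservesKernel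
    ((sheafToPresheaf J AddCommGrpCat.{w}) ⋙ (evaluation _ _).obj X) inferInstance inferInstance)
      m hm

end

/-! ### The extension of `ℤ` attached to a torsor -/

namespace SheafTorsor

universe w

variable {D : Type w} [SmallCategory.{w} D] {J : GrothendieckTopology D}
  {G : Sheaf J AddCommGrpCat.{w}} {P : Sheaf J (Type w)} (τ : SheafTorsor G P)

/-- The relations `[g + x] = g + [x]` between elements of `G(X) × ℤ[P(X)]`. -/
def relations (X : Dᵒᵖ) : AddSubgroup (G.obj.obj X × FreeAbelianGroup (P.obj.obj X)) :=
  AddSubgroup.closure (Set.range fun z : G.obj.obj X × P.obj.obj X =>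
    (z.1, FreeAbelianGroup.of z.2 - FreeAbelianGroup.of (τ.vadd X z.1 z.2)))

/-- The group generated by `G(X)` and `P(X)`, with the relations `[g + x] = g + [x]`. -/
abbrev Extended (X : Dᵒᵖ) : Type w :=
  (G.obj.obj X × FreeAbelianGroup (P.obj.obj X)) ⧸ τ.relations X

namespace Extended

variable {X Y : Dᵒᵖ}

/-- The map `G(X) → Extended`. -/
def inl (X : Dᵒᵖ) : G.obj.obj X →+ τ.Extended X :=
  (QuotientAddGroup.mk' _).comp (AddMonoidHom.inl _ _)

/-- The map `P(X) → Extended`. -/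
def of (x : P.obj.obj X) : τ.Extended X :=
  QuotientAddGroup.mk' _ (0, FreeAbelianGroup.of x)

lemma of_vadd (g : G.obj.obj X) (x : P.obj.obj X) :
    of τ (τ.vadd X g x) = inl τ X g + of τ x := by
  rw [inl, of, of, AddMonoidHom.comp_apply, ← map_add]
  refine (QuotientAddGroup.eq (s := τ.relations X)).2 ?_
  refine AddSubgroup.subset_closure ⟨(g, x), ?_⟩
  refine Prod.ext ?_ ?_
  · simp
  · simp [sub_eq_neg_add]

variable {τ} in
/-- The homomorphism determined by its values on `G(X)` and on `P(X)`. -/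
def lift {H : Type*} [AddCommGroup H] (a : G.obj.obj X →+ H) (b : P.obj.obj X → H)
    (h : ∀ g x, b (τ.vadd X g x) = a g + b x) : τ.Extended X →+ H :=
  QuotientAddGroup.lift _ (a.coprod (FreeAbelianGroup.lift b)) <| by
    rw [relations, AddSubgroup.closure_le]
    rintro _ ⟨⟨g, x⟩, rfl⟩
    simp [h]

@[simp]
lemma lift_inl {H : Type*} [AddCommGroup H] (a : G.obj.obj X →+ H) (b : P.obj.obj X → H)
    (h : ∀ g x, b (τ.vadd X g x) = a g + b x) (g : G.obj.obj X) : lift a b h (inl τ X g) = a g := by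
  change a g + FreeAbelianGroup.lift b 0 = a g
  rw [map_zero, add_zero]

@[simp]
lemma lift_of {H : Type*} [AddCommGroup H] (a : G.obj.obj X →+ H) (b : P.obj.obj X → H)
    (h : ∀ g x, b (τ.vadd X g x) = a g + b x) (x : P.obj.obj X) : lift a b h (of τ x) = b x := by
  change a 0 + FreeAbelianGroup.lift b (FreeAbelianGroup.of x) = b x
  rw [map_zero, zero_add, FreeAbelianGroup.lift_apply_of]

variable {τ} in
lemma hom_ext {H : Type*} [AddCommGroup H] {f f' : τ.Extended X →+ H}
    (h₁ : ∀ g, f (inl τ X g) = f' (inl τ X g)) (h₂ : ∀ x, f (of τ x) = f' (of τ x)) : f = f' := by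
  refine QuotientAddGroup.addMonoidHom_ext _ (AddMonoidHom.ext fun ⟨g, z⟩ => ?_)
  have h₃ : ((f.comp (QuotientAddGroup.mk' _)).comp (AddMonoidHom.inr _ _) :
      FreeAbelianGroup (P.obj.obj X) →+ H) =
      (f'.comp (QuotientAddGroup.mk' _)).comp (AddMonoidHom.inr _ _) :=
    FreeAbelianGroup.lift_ext _ _ h₂
  have e : (g, z) = (g, 0) + (0, z) := by simp
  rw [e, map_add, map_add]
  exact congrArg₂ (· + ·) (h₁ g) (DFunLike.congr_fun h₃ z)

/-- The map `Extended → ℤ`. -/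
def degree (X : Dᵒᵖ) : τ.Extended X →+ ULift.{w} ℤ :=
  lift 0 (fun _ => ULift.up 1) fun _ _ => by simp

/-- A point `x₀` of `P(X)` identifies the extended group with `G(X) × ℤ`; without points it is
`G(X)` alone. The retraction depends on `x₀` and is not natural in `X`, but injectivity and
exactness are checked for each `X` separately. -/
lemma exists_retraction (X : Dᵒᵖ) : ∃ ρ : τ.Extended X →+ G.obj.obj X,
    (∀ g, ρ (inl τ X g) = g) ∧ ∀ m, degree τ X m = 0 → inl τ X (ρ m) = m := by
  cases isEmpty_or_nonempty (P.obj.obj X) with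
  | inl h =>
    refine ⟨lift (AddMonoidHom.id _) isEmptyElim fun _ x => isEmptyElim x, by simp, fun m _ => ?_⟩
    refine DFunLike.congr_fun (f := (inl τ X).comp _) (g := AddMonoidHom.id _) (hom_ext ?_ ?_) m
    · simp
    · exact fun x => isEmptyElim x
  | inr h =>
    obtain ⟨x₀⟩ := h
    have h : ∀ x, ∃ g, τ.vadd X g x₀ = x := fun x => by
      obtain ⟨⟨g, y⟩, hz⟩ := (τ.bijective X).2 (x, x₀)
      obtain ⟨h₁, rfl⟩ := Prod.mk.inj hz
      exact ⟨g, h₁⟩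
    choose d hd using h
    have hd' : ∀ g x, d (τ.vadd X g x) = g + d x := fun g x => by
      have h : τ.vadd X (d (τ.vadd X g x)) x₀ = τ.vadd X (g + d x) x₀ := by
        rw [hd, τ.add_vadd, hd]
      exact congrArg Prod.fst ((τ.bijective X).1 (a₁ := (_, x₀)) (a₂ := (_, x₀))
        (Prod.ext h rfl))
    refine ⟨lift (AddMonoidHom.id _) d hd', by simp, fun m hm => ?_⟩
    -- Every element is the sum of its retraction and of its degree times `[x₀]`; in degree zero the
    -- second term disappears.
    have key : (inl τ X).comp (lift (AddMonoidHom.id _) d hd') +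
        ((zmultiplesHom _ (of τ x₀)).comp AddEquiv.ulift.toAddMonoidHom).comp (degree τ X) =
          AddMonoidHom.id _ := by
      refine hom_ext (fun g => ?_) fun x => ?_
      · simp [degree]
      · have : of τ x = inl τ X (d x) + of τ x₀ := by rw [← of_vadd, hd]
        change inl τ X (lift _ d hd' (of τ x)) + (degree τ X (of τ x)).down • of τ x₀ = of τ x
        rw [lift_of, degree, lift_of, one_zsmul, ← this]
    have := DFunLike.congr_fun key m
    simpa [hm] using this

end Extended

lemma of_map_vadd {X Y : Dᵒᵖ} (f : X ⟶ Y) (g : G.obj.obj X) (x : P.obj.obj X) :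
    Extended.of τ (P.obj.map f (τ.vadd X g x)) =
      (Extended.inl τ Y).comp (G.obj.map f).hom g + Extended.of τ (P.obj.map f x) := by
  rw [τ.map_vadd, Extended.of_vadd]
  rfl

/-- The presheaf `X ↦ Extended X`. -/
def extendedPresheaf : Dᵒᵖ ⥤ AddCommGrpCat.{w} where
  obj X := AddCommGrpCat.of (τ.Extended X)
  map {X Y} f := AddCommGrpCat.ofHom (Extended.lift ((Extended.inl τ Y).comp (G.obj.map f).hom)
    (fun x => Extended.of τ (P.obj.map f x)) (τ.of_map_vadd f))
  map_id X := by
    refine AddCommGrpCat.hom_ext (Extended.hom_ext (fun g => ?_) fun x => ?_)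
    · simp
    · simp
  map_comp f g := by
    refine AddCommGrpCat.hom_ext (Extended.hom_ext (fun g => ?_) fun x => ?_)
    · simp
    · simp

lemma extendedPresheaf_map_of {X Y : Dᵒᵖ} (f : X ⟶ Y) (x : P.obj.obj X) :
    τ.extendedPresheaf.map f (Extended.of τ x) = Extended.of τ (P.obj.map f x) :=
  Extended.lift_of τ _ _ (τ.of_map_vadd f) x

lemma extendedPresheaf_map_inl {X Y : Dᵒᵖ} (f : X ⟶ Y) (g : G.obj.obj X) :
    τ.extendedPresheaf.map f (Extended.inl τ X g) = Extended.inl τ Y (G.obj.map f g) :=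
  Extended.lift_inl τ _ _ (τ.of_map_vadd f) g

lemma degree_inl (X : Dᵒᵖ) (g : G.obj.obj X) : Extended.degree τ X (Extended.inl τ X g) = 0 :=
  Extended.lift_inl τ _ _ (fun _ _ => by simp) g

lemma degree_of {X : Dᵒᵖ} (x : P.obj.obj X) :
    Extended.degree τ X (Extended.of τ x) = ULift.up 1 :=
  Extended.lift_of τ _ _ (fun _ _ => by simp) x

/-- The short complex `G → Extended → ℤ` of presheaves. -/
def extendedComplex : ShortComplex (Dᵒᵖ ⥤ AddCommGrpCat.{w}) where
  X₁ := G.obj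
  X₂ := τ.extendedPresheaf
  X₃ := (Functor.const Dᵒᵖ).obj (AddCommGrpCat.of (ULift.{w} ℤ))
  f :=
    { app := fun X => AddCommGrpCat.ofHom (Extended.inl τ X)
      naturality := fun X Y f => by
        ext g
        exact (τ.extendedPresheaf_map_inl f g).symm }
  g :=
    { app := fun X => AddCommGrpCat.ofHom (Extended.degree τ X)
      naturality := fun X Y f => by
        refine AddCommGrpCat.hom_ext (Extended.hom_ext (fun g => ?_) fun x => ?_)
        · simp [extendedPresheaf, Extended.degree]
        · simp [extendedPresheaf, Extended.degree] }
  zero := by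
    ext X g
    exact τ.degree_inl X g

lemma extendedComplex_exact : τ.extendedComplex.Exact := by
  rw [ShortComplex.exact_iff_isZero_homology]
  refine Functor.isZero _ fun X => ?_
  refine IsZero.of_iso ?_ (τ.extendedComplex.mapHomologyIso ((evaluation _ _).obj X)).symm
  rw [← ShortComplex.exact_iff_isZero_homology, ShortComplex.ab_exact_iff]
  intro m hm
  obtain ⟨ρ, -, h⟩ := Extended.exists_retraction τ X
  exact ⟨ρ m, h m hm⟩

lemma mono_extendedComplex_f : Mono τ.extendedComplex.f := by
  have (X : Dᵒᵖ) : Mono (τ.extendedComplex.f.app X) := by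
    obtain ⟨ρ, h, -⟩ := Extended.exists_retraction τ X
    exact (AddCommGrpCat.mono_iff_injective _).2 (Function.LeftInverse.injective h)
  exact NatTrans.mono_of_mono_app _

/-- Where `P` has a point `x`, the element `n • [x]` has degree `n`. Over an `X` without points the
degree is zero, so surjectivity holds only locally. -/
lemma isLocallySurjective_extendedComplex_g :
    Presheaf.IsLocallySurjective J τ.extendedComplex.g where
  imageSieve_mem {X} n := by
    obtain ⟨S, hS, h⟩ := τ.locally_nonempty X
    refine J.superset_covering (fun Y f hf => ?_) hS
    obtain ⟨x⟩ := h f hf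
    refine ⟨(n : ULift.{w} ℤ).down • Extended.of τ x, ?_⟩
    refine (map_zsmul (Extended.degree τ _) _ _).trans ?_
    refine (congrArg _ (τ.degree_of x)).trans ?_
    exact ULift.ext _ _ (by simp; rfl)

/-- The extension of `ℤ` by `G` attached to a torsor. -/
noncomputable def extension : ShortComplex (Sheaf J AddCommGrpCat.{w}) where
  X₁ := G
  X₂ := (presheafToSheaf J _).obj τ.extendedPresheaf
  X₃ := constInt J
  f := ⟨τ.extendedComplex.f ≫ toSheafify J _⟩
  g := (presheafToSheaf J _).map τ.extendedComplex.g
  zero := by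
    refine Sheaf.hom_ext ?_
    change (τ.extendedComplex.f ≫ toSheafify J _) ≫ sheafifyMap J τ.extendedComplex.g = 0
    rw [Category.assoc, ← toSheafify_naturality, τ.extendedComplex.zero_assoc, zero_comp]

/-- The extension attached to a torsor is a sheafification. -/
noncomputable def extensionIso :
    τ.extension ≅ τ.extendedComplex.map (presheafToSheaf J AddCommGrpCat.{w}) :=
  ShortComplex.isoMk (sheafificationIso G) (Iso.refl _) (Iso.refl _) (by
    refine Sheaf.hom_ext ?_
    refine (toSheafify_naturality J τ.extendedComplex.f).symm.trans ?_
    exact (Category.comp_id _).symm) (by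
    refine (Category.id_comp _).trans (Category.comp_id _).symm)

/-- Sheafification is exact and turns local surjectivity into an epimorphism. The passage through
`extensionIso` is needed because the first term of `extension` is `G` itself and not its
sheafification, which puts the class in `G.H 1`. -/
lemma extension_shortExact : τ.extension.ShortExact := by
  have := τ.mono_extendedComplex_f
  have hg : Epi ((presheafToSheaf J AddCommGrpCat.{w}).map τ.extendedComplex.g) := by
    have := (Presheaf.isLocallySurjective_presheafToSheaf_map_iff (J := J) _).2
      τ.isLocallySurjective_extendedComplex_g
    infer_instance
  refine ShortComplex.shortExact_of_iso τ.extensionIso.symm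
    { exact := τ.extendedComplex_exact.map_of_mono_of_preservesKernel _ inferInstance inferInstance
      mono_f := ?_
      epi_g := hg }
  exact inferInstanceAs (Mono ((presheafToSheaf J AddCommGrpCat.{w}).map τ.extendedComplex.f))

end SheafTorsor

/-! ### Existence, uniqueness and vanishing of the class -/

namespace SheafTorsor

universe w

variable {D : Type w} [SmallCategory.{w} D] {J : GrothendieckTopology D}
  {G : Sheaf J AddCommGrpCat.{w}} {P : Sheaf J (Type w)} (τ : SheafTorsor G P)

variable (J) in
/-- The map from `ℤ` to the sections over `X` of the constant sheaf `ℤ`. -/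
noncomputable abbrev constIntUnit (X : Dᵒᵖ) : ULift.{w} ℤ →+ (constInt J).obj.obj X :=
  ((toSheafify J ((Functor.const Dᵒᵖ).obj (AddCommGrpCat.of (ULift.{w} ℤ)))).app X).hom

lemma toSheafify_comp_extension_g :
    toSheafify J τ.extendedPresheaf ≫ τ.extension.g.hom = τ.extendedComplex.g ≫ toSheafify J _ :=
  (toSheafify_naturality J τ.extendedComplex.g).symm

theorem isClass_extension : τ.IsClass τ.extension_shortExact.extClass := by
  refine ⟨_, τ.extension.f, τ.extension.g, τ.extension.zero, τ.extension_shortExact,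
    { app := fun X => TypeCat.ofHom fun x =>
        (toSheafify J τ.extendedPresheaf).app X (Extended.of τ x)
      naturality := fun X Y f => ?_ }, fun X g x => ?_, fun X x => ?_, rfl⟩
  · ext x
    refine (congrArg _ (τ.extendedPresheaf_map_of f x).symm).trans ?_
    exact ConcreteCategory.congr_hom ((toSheafify J τ.extendedPresheaf).naturality f)
      (Extended.of τ x)
  · refine (congrArg ((toSheafify J τ.extendedPresheaf).app X) (Extended.of_vadd τ g x)).trans ?_
    exact map_add _ _ _
  · refine (ConcreteCategory.congr_hom (NatTrans.congr_app τ.toSheafify_comp_extension_g X)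
      (Extended.of τ x)).trans ?_
    exact congrArg (constIntUnit J X) (τ.degree_of x)

variable {τ}

/-- Equivariance of `s` is exactly what is needed to extend `i` and `s` to the extended group. The
resulting morphism of extensions is the identity on `G` and on `ℤ`, so naturality equates the two
classes. -/
theorem IsClass.eq_extClass {ω : G.H 1} (h : τ.IsClass ω) :
    ω = τ.extension_shortExact.extClass := by
  obtain ⟨M, i, p, hip, hM, s, hs, hp, rfl⟩ := h
  let η : τ.extendedPresheaf ⟶ M.obj :=
    { app := fun X => AddCommGrpCat.ofHom
        (Extended.lift (i.hom.app X).hom (fun x => s.app X x) (hs X))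
      naturality := fun X Y f => by
        refine AddCommGrpCat.hom_ext (Extended.hom_ext (fun g => ?_) fun x => ?_)
        · refine (congrArg (Extended.lift (i.hom.app Y).hom (fun x => s.app Y x) (hs Y))
            (τ.extendedPresheaf_map_inl f g)).trans ?_
          refine (Extended.lift_inl τ _ _ (hs Y) _).trans ?_
          refine (ConcreteCategory.congr_hom (i.hom.naturality f) g).trans ?_
          exact congrArg (M.obj.map f) (Extended.lift_inl τ _ _ (hs X) g).symm
        · refine (congrArg (Extended.lift (i.hom.app Y).hom (fun x => s.app Y x) (hs Y))
            (τ.extendedPresheaf_map_of f x)).trans ?_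
          refine (Extended.lift_of τ _ _ (hs Y) _).trans ?_
          refine (ConcreteCategory.congr_hom (s.naturality f) x).trans ?_
          exact congrArg (M.obj.map f) (Extended.lift_of τ _ _ (hs X) x).symm }
  let f : τ.extension.X₂ ⟶ M := ⟨sheafifyLift J η M.property⟩
  have hf : toSheafify J τ.extendedPresheaf ≫ f.hom = η := toSheafify_sheafifyLift J η M.property
  let F : τ.extension ⟶ ShortComplex.mk i p hip :=
    { τ₁ := 𝟙 _
      τ₂ := f
      τ₃ := 𝟙 _
      comm₁₂ := by
        refine (Category.id_comp i).trans (Sheaf.hom_ext (Eq.symm ?_))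
        refine (Category.assoc τ.extendedComplex.f (toSheafify J _) f.hom).trans ?_
        refine (congrArg (fun f => τ.extendedComplex.f ≫ f) hf).trans ?_
        ext X g
        exact Extended.lift_inl τ _ _ (hs X) g
      comm₂₃ := by
        refine Eq.trans ?_ (Category.comp_id _).symm
        refine Sheaf.hom_ext (sheafify_hom_ext J _ _ (constInt J).property ?_)
        refine (Category.assoc _ f.hom p.hom).symm.trans ?_
        refine (congrArg (fun f => f ≫ p.hom) hf).trans ?_
        refine Eq.trans ?_ τ.toSheafify_comp_extension_g.symm
        ext X : 2
        refine AddCommGrpCat.hom_ext (Extended.hom_ext (fun g => ?_) fun x => ?_)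
        · refine (congrArg (p.hom.app X) (Extended.lift_inl τ _ _ (hs X) g)).trans ?_
          refine (ConcreteCategory.congr_hom (congrArg (fun f => f.hom.app X) hip) g).trans ?_
          refine Eq.trans ?_ (congrArg (constIntUnit J X) (τ.degree_inl X g)).symm
          exact (map_zero (constIntUnit J X)).symm
        · refine (congrArg (p.hom.app X) (Extended.lift_of τ _ _ (hs X) x)).trans ?_
          refine (hp X x).trans ?_
          exact (congrArg (constIntUnit J X) (τ.degree_of x)).symm }
  have := τ.extension_shortExact.extClass_naturality hM F
  exact ((Abelian.Ext.mk₀_id_comp hM.extClass).symm.trans this.symm).trans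
    (Abelian.Ext.comp_mk₀_id _)

/-- A splitting is a global section of `M` above `1`, and `s` identifies `P` with the sheaf of such
sections. -/
theorem IsClass.eq_zero_iff {ω : G.H 1} (h : τ.IsClass ω) {X₀ : D} (h₀ : IsTerminal X₀) :
    ω = 0 ↔ Nonempty (P.obj.obj (op X₀)) := by
  obtain ⟨M, i, p, hip, hM, s, hs, hp, rfl⟩ := h
  have hsnat : ∀ {X Y : Dᵒᵖ} (f : X ⟶ Y) (x : P.obj.obj X),
      (s.app Y (P.obj.map f x) : M.obj.obj Y) = M.obj.map f (s.app X x) := fun f x =>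
    ConcreteCategory.congr_hom (s.naturality f) x
  have hi := sections_injective hM
  rw [hM.extClass_eq_zero_iff]
  refine ⟨fun ⟨σ, hσ⟩ => ?_, fun ⟨x⟩ => ?_⟩
  · have hs_inj : ∀ {X : Dᵒᵖ} (x y : P.obj.obj X), s.app X x = s.app X y → x = y := by
      intro X x y hxy
      obtain ⟨⟨g, z⟩, hz⟩ := (τ.bijective X).2 (y, x)
      obtain ⟨h₁, rfl⟩ := Prod.mk.inj hz
      have h₂ : (i.hom.app X g : M.obj.obj X) + s.app X z = s.app X z :=
        (hs X g z).symm.trans ((congrArg _ h₁).trans hxy.symm)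
      have h₃ : g = 0 := hi X ((add_eq_right.1 h₂).trans (map_zero _).symm)
      refine (τ.zero_vadd X z).symm.trans (Eq.trans ?_ h₁)
      rw [h₃]
    let m : M.obj.obj (op X₀) := σ.hom.app _ (constOne J _)
    have hm : p.hom.app _ m = constOne J (op X₀) :=
      ConcreteCategory.congr_hom (congrArg (fun f => f.hom.app (op X₀)) hσ) (constOne J (op X₀))
    obtain ⟨S, hS, hP⟩ := τ.locally_nonempty X₀
    -- Two liftings of `1` differ by a section of `G`, so near a point of `P` the section `m` comes
    -- from `P`; injectivity of `s` then makes the local points compatible.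
    have hloc : ∀ (Y : D) (f : Y ⟶ X₀), S f → ∃ x : P.obj.obj (op Y),
        s.app _ x = M.obj.map f.op m := by
      intro Y f hf
      obtain ⟨y⟩ := hP f hf
      obtain ⟨g, hg⟩ := sections_exact hM (op Y)
        (M.obj.map f.op m - (s.app (op Y) y : M.obj.obj (op Y))) (by
          change p.hom.app _ _ = 0
          rw [map_sub, hp, sub_eq_zero]
          refine (ConcreteCategory.congr_hom (p.hom.naturality f.op) m).trans ?_
          exact (congrArg _ hm).trans (map_constOne f.op))
      exact ⟨τ.vadd _ g y, (hs _ g y).trans (eq_sub_iff_add_eq.1 hg)⟩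
    choose x hx using hloc
    have hP' := (isSheaf_iff_isSheaf_of_type _ _).1 P.property S hS
    let x' : Presieve.FamilyOfElements P.obj (S : Presieve X₀) := fun Y f hf => x Y f hf
    have hx' : x'.Compatible := by
      rw [Presieve.compatible_iff_sieveCompatible]
      intro Y Z f g hf
      refine hs_inj _ _ ((hx _ _ _).trans (Eq.trans ?_ (hsnat _ _).symm))
      refine Eq.trans ?_ (congrArg (M.obj.map g.op) (hx Y f hf)).symm
      rw [op_comp, M.obj.map_comp]
      rfl
    obtain ⟨t, -, -⟩ := hP' x' hx'
    exact ⟨t⟩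
  · obtain ⟨σ, hσ⟩ := exists_constInt_hom M (fun X => s.app X (P.obj.map (h₀.from X.unop).op x))
      fun {X Y} f => (hsnat f _).symm.trans <| congrArg (s.app Y) <| by
        rw [← ConcreteCategory.comp_apply, ← P.obj.map_comp]
        congr 3
        exact Quiver.Hom.unop_inj (h₀.hom_ext _ _)
    refine ⟨σ, constInt_hom_ext fun X => ?_⟩
    exact (congrArg (p.hom.app X) (hσ X)).trans (hp X _)

end SheafTorsor

/-! ### Global sections of the torsor and liftings of `φ` -/

section

universe w

variable {D : Type w} [SmallCategory.{w} D] {J : GrothendieckTopology D}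
  {G : Sheaf J AddCommGrpCat.{w}} {P : Sheaf J (Type w)}

/-- The sections of a torsor form a torsor under the sections of the group. -/
noncomputable abbrev SheafTorsor.addTorsorOfEquiv (τ : SheafTorsor G P) {X : Dᵒᵖ} {H L : Type*}
    [AddCommGroup H] (e : H ≃+ G.obj.obj X) (ε : P.obj.obj X ≃ L) [Nonempty L] :
    AddTorsor H L where
  vadd x l := ε (τ.vadd X (e x) (ε.symm l))
  vsub l l' := e.symm ((Equiv.ofBijective _ (τ.bijective X)).symm (ε.symm l, ε.symm l')).1
  zero_vadd l := by
    change ε (τ.vadd X (e 0) (ε.symm l)) = l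
    rw [map_zero, τ.zero_vadd, Equiv.apply_symm_apply]
  add_vadd x y l := by
    change ε (τ.vadd X (e (x + y)) (ε.symm l)) =
      ε (τ.vadd X (e x) (ε.symm (ε (τ.vadd X (e y) (ε.symm l)))))
    rw [map_add, τ.add_vadd, Equiv.symm_apply_apply]
  vsub_vadd' l l' := by
    change ε (τ.vadd X (e (e.symm
      ((Equiv.ofBijective _ (τ.bijective X)).symm (ε.symm l, ε.symm l')).1)) (ε.symm l')) = l
    obtain ⟨⟨g, y⟩, h⟩ := (τ.bijective X).2 (ε.symm l, ε.symm l')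
    have h' : Equiv.ofBijective _ (τ.bijective X) (g, y) = (ε.symm l, ε.symm l') := h
    rw [← h', Equiv.symm_apply_apply, AddEquiv.apply_symm_apply, ← (Prod.mk.inj h).2,
      (Prod.mk.inj h).1, Equiv.apply_symm_apply]
  vadd_vsub' x l := by
    change e.symm ((Equiv.ofBijective _ (τ.bijective X)).symm
      (ε.symm (ε (τ.vadd X (e x) (ε.symm l))), ε.symm l)).1 = x
    have h : Equiv.ofBijective _ (τ.bijective X) (e x, ε.symm l) =
      (τ.vadd X (e x) (ε.symm l), ε.symm l) := rfl
    rw [Equiv.symm_apply_apply, ← h, Equiv.symm_apply_apply, AddEquiv.symm_apply_apply]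

end

section

variable {E : Type (u + 1)} [LargeCategory.{u} E] {K : GrothendieckTopology E}
  {A : Sheaf K CommRingCat.{u}} {B C C' B' : Under A}

open AlgOver

section

variable {φ : B ⟶ C} {M : AlgModule C}

lemma Der.pull_restrict (δ : Der φ M) {X Y : AlgOver B} (f : X ⟶ Y) :
    LocalDer.pull f (δ.restrict Y) = δ.restrict X :=
  LocalDer.ext' fun v c => congrArg (δ.app _) (f.app_proj_apply (v := v) rfl c)

variable (φ M) in
/-- Derivations of `B` are sections over the final object. -/
noncomputable def derEquiv {T : E} (hT : IsTerminal T) :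
    Der φ M ≃+ LocalDer φ M (ofUnder T (𝟙 B)) :=
  AddEquiv.ofBijective (AddMonoidHom.mk' (fun δ => δ.restrict (ofUnder T (𝟙 B)))
    fun _ _ => rfl) <| by
    refine ⟨fun δ δ' h => ?_, fun d => ?_⟩
    · refine Der.ext (funext fun U => AddMonoidHom.ext fun b => ?_)
      exact congrArg (fun d : LocalDer φ M (ofUnder T (𝟙 B)) => d.app (hT.from U.unop) b) h
    · refine ⟨{ app := fun U => d.app (hT.from U.unop)
                naturality := fun {U V} k b =>
                  d.naturality k.unop (hT.from U.unop) (hT.from V.unop) (hT.hom_ext _ _) b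
                leibniz := fun U b c => d.leibniz (hT.from U.unop) b c
                app_str := fun U a => d.app_str (hT.from U.unop) a }, ?_⟩
      refine LocalDer.ext' fun {V} v b => ?_
      obtain rfl := hT.hom_ext v (hT.from V)
      rfl

end

variable {π : C' ⟶ C} {φ : B ⟶ C} {p : B' ⟶ C'} {q : B' ⟶ B} (hB' : IsPullback p q π φ)
  {T : E} (hT : IsTerminal T)

/-- The action of a derivation on a morphism to `(T, B')`. -/
noncomputable def liftVadd {M : AlgModule C} (S : SquareZeroExtension π M) {X : AlgOver B}
    (d : LocalDer φ M X) (ψ : X ⟶ ofUnder T q) : X ⟶ ofUnder T q :=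
  (exists_vadd hB' hT S d ψ).choose

lemma toLift_liftVadd {M : AlgModule C} (S : SquareZeroExtension π M) {X : AlgOver B}
    (d : LocalDer φ M X) (ψ : X ⟶ ofUnder T q) {V : E} (v : V ⟶ X.base) (c : X.sec v) :
    toLift p (liftVadd hB' hT S d ψ) v c = S.incl (op V) (d.app v c) + toLift p ψ v c :=
  (exists_vadd hB' hT S d ψ).choose_spec v c

/-- The torsor of liftings of `φ` attached to a square-zero extension. -/
noncomputable def liftTorsor {M : AlgModule C} (S : SquareZeroExtension π M) :
    SheafTorsor (J := AlgOver.topology B) ⟨derPresheaf φ M, derPresheaf_isSheaf φ M⟩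
      ⟨yoneda.obj (ofUnder T q), isSheaf_yoneda_ofUnder q hT⟩ :=
  have spec {X : AlgOver B} (d : LocalDer φ M X) (ψ : X ⟶ ofUnder T q) {V : E} (v : V ⟶ X.base)
      (c : X.sec v) := toLift_liftVadd hB' hT S d ψ v c
  { vadd := fun X d ψ => liftVadd hB' hT S (X := X.unop) d ψ
    zero_vadd := fun X ψ => hom_ext_toLift hB' hT fun v c => by
      refine (spec (X := X.unop) 0 ψ v c).trans ?_
      exact (congrArg (· + _) (map_zero _)).trans (zero_add _)
    add_vadd := fun X d d' ψ => hom_ext_toLift hB' hT fun {V} v c => by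
      refine (spec (X := X.unop) (d + d') ψ v c).trans ?_
      refine Eq.trans ?_ ((spec (X := X.unop) d _ v c).trans
        (congrArg _ (spec (X := X.unop) d' ψ v c))).symm
      exact (congrArg (· + _) (map_add (S.incl (op V)) _ _)).trans (add_assoc _ _ _)
    map_vadd := fun {X Y} f d ψ => hom_ext_toLift hB' hT fun {V} v c => by
      refine (toLift_comp p f.unop _ rfl c).trans ?_
      refine (spec (X := X.unop) d ψ _ _).trans ?_
      refine Eq.trans ?_ (spec (X := Y.unop) (LocalDer.pull f.unop d) (f.unop ≫ ψ) v c).symm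
      exact congrArg (_ + ·) (toLift_comp p f.unop ψ rfl c).symm
    bijective := fun X => by
      refine ⟨?_, ?_⟩
      · rintro ⟨d, ψ⟩ ⟨d', ψ'⟩ h
        obtain ⟨h₁, rfl⟩ := Prod.mk.inj h
        refine Prod.ext (LocalDer.ext' fun {V} v c => S.injective (op V) ?_) rfl
        refine add_right_cancel (b := toLift p ψ v c) ?_
        refine (spec (X := X.unop) d ψ v c).symm.trans (Eq.trans ?_ (spec (X := X.unop) d' ψ v c))
        exact congrArg (fun ψ : X.unop ⟶ ofUnder T q => toLift p ψ v c) h₁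
      · rintro ⟨ψ', ψ⟩
        obtain ⟨d, hd⟩ := exists_sub hB' S (X := X.unop) ψ ψ'
        refine ⟨(d, ψ), Prod.ext (hom_ext_toLift hB' hT fun {V} v c => ?_) rfl⟩
        exact (spec (X := X.unop) d ψ v c).trans (hd v c).symm
    locally_nonempty := locally_exists_hom hB' hT S }

lemma toLift_liftTorsor_vadd {M : AlgModule C} (S : SquareZeroExtension π M) {X : AlgOver B}
    (d : LocalDer φ M X) (ψ : X ⟶ ofUnder T q) {V : E} (v : V ⟶ X.base) (c : X.sec v) :
    toLift p ((liftTorsor hB' hT S).vadd (op X) d ψ : X ⟶ ofUnder T q) v c =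
      S.incl (op V) (d.app v c) + toLift p ψ v c :=
  toLift_liftVadd hB' hT S d ψ v c

/-- The lifting `B ⟶ C'` of `φ` defined by a section over the final object. -/
def liftOfHom (ψ : ofUnder T (𝟙 B) ⟶ ofUnder T q) : B ⟶ C' :=
  Under.homMk
    (⟨{ app := fun U => CommRingCat.ofHom (toLift p ψ (hT.from U.unop))
        naturality := fun U V k => by
          ext b
          exact toLift_res p ψ k.unop (hT.from U.unop) (hT.from V.unop) (hT.hom_ext _ _) b }⟩ :
      B.right ⟶ C'.right) (by
    refine Sheaf.hom_ext ?_
    ext U a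
    exact toLift_strAt p ψ (hT.from U.unop) a)

include hB' in
lemma liftOfHom_comp (ψ : ofUnder T (𝟙 B) ⟶ ofUnder T q) : liftOfHom hT ψ (p := p) ≫ π = φ := by
  refine Under.UnderMorphism.ext (Sheaf.hom_ext ?_)
  ext U b
  exact toLift_proj hB' ψ (hT.from U.unop) b

/-- Sections of the torsor over the final object are liftings of `φ`. -/
noncomputable def homEquivLift :
    (ofUnder T (𝟙 B) ⟶ ofUnder T q) ≃ {ψ : B ⟶ C' // ψ ≫ π = φ} :=
  Equiv.ofBijective (fun ψ => ⟨liftOfHom hT ψ, liftOfHom_comp hB' hT ψ⟩) <| by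
    refine ⟨fun ψ ψ' h => hom_ext_toLift hB' hT fun {V} v b => ?_, fun ⟨f, hf⟩ => ?_⟩
    · obtain rfl := hT.hom_ext v (hT.from V)
      exact congrArg (fun f : {ψ : B ⟶ C' // ψ ≫ π = φ} => f.1.right.hom.app (op V) b) h
    · obtain ⟨ψ, hψ⟩ := exists_hom_toLift hB' hT (X := ofUnder T (𝟙 B))
        (fun {V} _ => (f.right.hom.app (op V)).hom)
        (fun k _ _ _ b => Under.map_right_app f k b)
        (fun _ a => Under.right_app_hom f a)
        (fun {V} _ b => congrArg (fun g : B ⟶ C => g.right.hom.app (op V) b) hf)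
      refine ⟨ψ, Subtype.ext (Under.UnderMorphism.ext (Sheaf.hom_ext ?_))⟩
      ext U b
      exact hψ (hT.from U.unop) b

end

theorem mainTheorem4 {E : Type (u + 1)} [LargeCategory.{u} E] (hE : IsTopos E)
    {A : Sheaf (Sheaf.canonicalTopology E) CommRingCat.{u}} {B C C' B' : Under A}
    (φ : B ⟶ C) (π : C' ⟶ C) (M : AlgModule C) (S : SquareZeroExtension π M)
    {p : B' ⟶ C'} {q : B' ⟶ B} (hB' : IsPullback p q π φ) {T : E} (hT : IsTerminal T) :
    ∃ (hG : Presheaf.IsSheaf (AlgOver.topology B) (derPresheaf φ M))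
      (hP : Presheaf.IsSheaf (AlgOver.topology B) (yoneda.obj (AlgOver.ofUnder T q)))
      (τ : SheafTorsor (J := AlgOver.topology B) ⟨derPresheaf φ M, hG⟩
        ⟨yoneda.obj (AlgOver.ofUnder T q), hP⟩),
      (∀ (X : AlgOver B) (D : LocalDer φ M X) (ψ : X ⟶ AlgOver.ofUnder T q) (V : E)
        (v : V ⟶ X.base) (w : V ⟶ T) (h : v ≫ (τ.vadd (op X) D ψ).base = w)
        (h' : v ≫ ψ.base = w) (c : X.sec v),
        p.right.hom.app (op V) ((τ.vadd (op X) D ψ).app v w h c) =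
          S.incl (op V) (D.app v c) + p.right.hom.app (op V) (ψ.app v w h' c)) ∧
      ∃ e : Sheaf.H (J := AlgOver.topology B) ⟨derPresheaf φ M, hG⟩ 0 ≃+ Der φ M,
        (∀ x (X : AlgOver B), sectionOfH0 x (op X) = (e x).restrict X) ∧
        ∃ ω : Sheaf.H (J := AlgOver.topology B) ⟨derPresheaf φ M, hG⟩ 1,
          τ.IsClass ω ∧ (∀ ω', τ.IsClass ω' → ω' = ω) ∧
          (ω = 0 ↔ ∃ s : B ⟶ B', s ≫ q = 𝟙 B) ∧
          (ω = 0 ↔ ∃ ψ : B ⟶ C', ψ ≫ π = φ) ∧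
          (ω = 0 →
            ∃ t : AddTorsor (Sheaf.H (J := AlgOver.topology B) ⟨derPresheaf φ M, hG⟩ 0)
                {ψ : B ⟶ C' // ψ ≫ π = φ},
              ∀ (x : Sheaf.H (J := AlgOver.topology B) ⟨derPresheaf φ M, hG⟩ 0)
                (ψ : {ψ : B ⟶ C' // ψ ≫ π = φ}) (U : Eᵒᵖ) (b : B.right.obj.obj U),
                (x +ᵥ ψ).1.right.hom.app U b =
                  S.incl U ((e x).app U b) + ψ.1.right.hom.app U b) := by
  -- All global statements are read off at this final object.
  have h₀ := AlgOver.isTerminalOfUnder hT B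
  let τ := liftTorsor hB' hT S
  let ε := sectionsH0 (J := AlgOver.topology B) ⟨derPresheaf φ M, derPresheaf_isSheaf φ M⟩ h₀
  let e := ε.trans (derEquiv φ M hT).symm
  have he : ∀ x, (e x).restrict (AlgOver.ofUnder T (𝟙 B)) = ε x := fun x =>
    (derEquiv φ M hT).apply_symm_apply (ε x)
  have hω := τ.isClass_extension
  have hlift : τ.extension_shortExact.extClass = 0 ↔ ∃ ψ : B ⟶ C', ψ ≫ π = φ := by
    refine (hω.eq_zero_iff h₀).trans ?_
    rw [← nonempty_subtype]
    exact (homEquivLift hB' hT).nonempty_congr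
  refine ⟨_, _, τ, fun X D ψ V v w h h' c => ?_, e, fun x X => ?_, _, hω,
    fun ω' h => h.eq_extClass, hlift.trans ⟨fun ⟨ψ, hψ⟩ => ?_, fun ⟨s, hs⟩ => ?_⟩, hlift,
    fun h => ?_⟩
  · refine (congrArg _ (AlgOver.app_eq_toUnder (τ.vadd (op X) D ψ) h c)).trans ?_
    refine (toLift_liftTorsor_vadd hB' hT S D ψ v c).trans ?_
    exact congrArg (fun b => S.incl (op V) (D.app v c) + p.right.hom.app (op V) b)
      (AlgOver.app_eq_toUnder ψ h' c).symm
  -- A global section is the pull-back of its value at the final object, and restricting a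
  -- derivation commutes with pull-back.
  · refine (map_sectionOfH0 x (h₀.from X).op).symm.trans ?_
    refine (congrArg (LocalDer.pull (h₀.from X)) (he x).symm).trans ?_
    exact (e x).pull_restrict (h₀.from X)
  · exact ⟨hB'.lift ψ (𝟙 B) (by rw [hψ, Category.id_comp]), hB'.lift_snd ..⟩
  · exact ⟨s ≫ p, by rw [Category.assoc, hB'.w, reassoc_of% hs]⟩
  · have : Nonempty {ψ : B ⟶ C' // ψ ≫ π = φ} := nonempty_subtype.2 (hlift.1 h)
    -- The action is that of `τ` over the final object, transported along `ε` and `homEquivLift`.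
    refine ⟨τ.addTorsorOfEquiv ε (homEquivLift hB' hT), fun x ψ U b => ?_⟩
    obtain ⟨Ψ, rfl⟩ := (homEquivLift hB' hT).surjective ψ
    change (homEquivLift hB' hT (τ.vadd _ (ε x) ((homEquivLift hB' hT).symm
      (homEquivLift hB' hT Ψ)))).1.right.hom.app U b = _
    rw [Equiv.symm_apply_apply, ← he x]
    exact toLift_liftTorsor_vadd hB' hT S ((e x).restrict _) Ψ (hT.from U.unop) b
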